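/- Let $(X_{i,k})_{i,k\ge 1}$ be an infinite array of i.i.d. standard normal random variables on a probability space, let $(p_n)_{n\ge1}$ be positive integers, and for each $n$ let $\boldsymbol X_i=(X_{i,1},\dots,X_{i,n})\in\mathbb R^n$, $1\le i\le p_n$, be the rows of the $p_n\times n$ matrix $(X_{i,k})_{1\le i\le p_n,\,1\le k\le n}$ (so the rows are a random sample of size $p_n$ from $N_n(\boldsymbol 0,\boldsymbol I_n)$). Put $$M_n=\max_{1\le i<j\le p_n}\|\boldsymbol X_i-\boldsymbol X_j\|_2 ,$$ where $\|\cdot\|_2$ is the Euclidean norm. Let $\beta\in(0,1/3]$ and suppose that $\log p_n=o(n^{\beta})$ as $n\to\infty$, and that $p_n$ grows at least polynomially, i.e. there are constants $c,\tau>0$ with $p_n\ge c\,n^{\tau}$ for all sufficiently large $n$. Then, as $n\to\infty$, $$\frac{M_n^2-2n}{2\sqrt{2n\log p_n}}\to 2\quad\text{almost surely.}$$ -/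

import Mathlib

open MeasureTheory ProbabilityTheory Filter Asymptotics Topology

noncomputable section

/-- The `i`-th row of the `p × n` matrix cut out of an infinite array `x`,
as a point of Euclidean `n`-space (rows and columns are numbered from `0`). -/
def arrayRow (x : ℕ → ℕ → ℝ) (n i : ℕ) : EuclideanSpace ℝ (Fin n) :=
  WithLp.toLp 2 (fun k : Fin n => x i k)

/-- The maximum interpoint distance `max_{i < j} ‖X_i - X_j‖₂` of the first `p` rows of length `n`.
The maximum is over a finite set, which is non-empty as soon as `p ≥ 2`. -/
def maxInterpointDist (x : ℕ → ℕ → ℝ) (p n : ℕ) : ℝ :=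
  ⨆ ij : {ij : Fin p × Fin p // ij.1 < ij.2},
    ‖arrayRow x n ij.1.1 - arrayRow x n ij.1.2‖

end

theorem iIndepFun_curry {Ω ι κ : Type*} {𝓧 : Type*} [MeasurableSpace 𝓧] [MeasurableSpace Ω]
    {P : Measure Ω} [IsProbabilityMeasure P]
    {X : ι → κ → Ω → 𝓧} (mX : ∀ i j, Measurable (X i j))
    (h : iIndepFun (fun p : ι × κ => X p.1 p.2) P) :
    iIndepFun (fun i ω j => X i j ω) P := by
  have hp : ∀ i j, IsProbabilityMeasure (P.map (X i j)) :=
    fun i j => Measure.isProbabilityMeasure_map (mX i j).aemeasurable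
  rw [iIndepFun_iff_map_fun_eq_infinitePi_map (by fun_prop)] at h ⊢
  have hr : ∀ i, P.map (fun ω j => X i j ω) = Measure.infinitePi (fun j => P.map (X i j)) := by
    intro i
    have := congrArg (fun m => m.map (fun (x : ι × κ → 𝓧) j => x (i, j))) h
    rw [Measure.map_map (by fun_prop) (by fun_prop),
      Measure.map_infinitePi_infinitePi_of_inj (f := fun j => (i, j))
        (by intro a b hab; simpa using hab)] at this
    exact this
  simp_rw [hr]
  rw [← Measure.infinitePi_map_curry (fun i j => P.map (X i j)), ← h,
    Measure.map_map (by fun_prop) (by fun_prop)]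
  rfl

theorem lintegral_exp_mul_sq_sub_gaussianReal {m : ℝ} (hm : m < 1 / 2) (a : ℝ) :
    ∫⁻ b, ENNReal.ofReal (Real.exp (m * (a - b) ^ 2)) ∂(gaussianReal 0 1) =
      ENNReal.ofReal ((√(1 - 2 * m))⁻¹ * Real.exp (m / (1 - 2 * m) * a ^ 2)) := by
  have h0 : 0 < 1 - 2 * m := by linarith
  rw [gaussianReal_of_var_ne_zero _ one_ne_zero,
    lintegral_withDensity_eq_lintegral_mul _ (measurable_gaussianPDF 0 1) (by fun_prop)]
  set t : ℝ := -2 * m * a / (1 - 2 * m) with ht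
  have key : ∀ b : ℝ, (gaussianPDF 0 1 * fun b => ENNReal.ofReal (Real.exp (m * (a - b) ^ 2))) b =
      ENNReal.ofReal ((√(2 * Real.pi))⁻¹ * Real.exp (m / (1 - 2 * m) * a ^ 2) *
        Real.exp (-((1 - 2 * m) / 2) * (b - t) ^ 2)) := by
    intro b
    simp only [Pi.mul_apply, gaussianPDF, gaussianPDFReal]
    rw [← ENNReal.ofReal_mul (by positivity)]
    congr 1
    simp only [NNReal.coe_one, mul_one, sub_zero]
    rw [mul_assoc, mul_assoc, ← Real.exp_add, ← Real.exp_add]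
    congr 2
    rw [ht]
    field_simp
    ring
  simp_rw [key]
  have hint : Integrable (fun b : ℝ => Real.exp (-((1 - 2 * m) / 2) * (b - t) ^ 2)) :=
    (integrable_exp_neg_mul_sq (b := (1 - 2 * m) / 2) (by positivity)).comp_sub_right t
  rw [← ofReal_integral_eq_lintegral_ofReal (hint.const_mul _)
    (ae_of_all _ fun b => by positivity), integral_const_mul,
    integral_sub_right_eq_self (fun b : ℝ => Real.exp (-((1 - 2 * m) / 2) * b ^ 2)) t,
    integral_gaussian]
  congr 1
  have : √(Real.pi / ((1 - 2 * m) / 2)) = √(2 * Real.pi) * (√(1 - 2 * m))⁻¹ := by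
    rw [← Real.sqrt_inv, ← Real.sqrt_mul (by positivity)]
    congr 1
    field_simp
  rw [this]
  have : √(2 * Real.pi) ≠ 0 := by positivity
  field_simp

theorem lintegral_exp_mul_sq_gaussianReal {m : ℝ} (hm : m < 1 / 2) :
    ∫⁻ b, ENNReal.ofReal (Real.exp (m * b ^ 2)) ∂(gaussianReal 0 1) =
      ENNReal.ofReal (√(1 - 2 * m))⁻¹ := by
  simpa using lintegral_exp_mul_sq_sub_gaussianReal hm 0

theorem lintegral_exp_sq_sub {m : ℝ} (hm : m < 1 / 4) :
    ∫⁻ a, ∫⁻ b, ENNReal.ofReal (Real.exp (m * (a - b) ^ 2)) ∂(gaussianReal 0 1)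
      ∂(gaussianReal 0 1) = ENNReal.ofReal (√(1 - 4 * m))⁻¹ := by
  have h0 : 0 < 1 - 2 * m := by linarith
  simp_rw [lintegral_exp_mul_sq_sub_gaussianReal (show m < 1 / 2 by linarith),
    ENNReal.ofReal_mul (inv_nonneg.2 (Real.sqrt_nonneg _))]
  rw [lintegral_const_mul _ (by fun_prop), lintegral_exp_mul_sq_gaussianReal,
    ← ENNReal.ofReal_mul (by positivity), ← mul_inv, ← Real.sqrt_mul h0.le]
  · congr 3; field_simp; ring
  · rw [div_lt_iff₀ h0]; linarith

theorem lintegral_exp_sq_sub_add_sq_sub {m : ℝ} (hm : m < 1 / 6) :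
    ∫⁻ a, ∫⁻ b, ∫⁻ c, ENNReal.ofReal (Real.exp (m * ((a - b) ^ 2 + (a - c) ^ 2)))
      ∂(gaussianReal 0 1) ∂(gaussianReal 0 1) ∂(gaussianReal 0 1) =
      ENNReal.ofReal ((√(1 - 2 * m))⁻¹ * (√(1 - 6 * m))⁻¹) := by
  have h0 : 0 < 1 - 2 * m := by linarith
  have h1 : m < 1 / 2 := by linarith
  simp_rw [mul_add, Real.exp_add, ENNReal.ofReal_mul (Real.exp_nonneg _)]
  have : ∀ a b : ℝ, ∫⁻ c, ENNReal.ofReal (Real.exp (m * (a - b) ^ 2)) *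
      ENNReal.ofReal (Real.exp (m * (a - c) ^ 2)) ∂(gaussianReal 0 1) =
      ENNReal.ofReal (Real.exp (m * (a - b) ^ 2)) *
      ENNReal.ofReal ((√(1 - 2 * m))⁻¹ * Real.exp (m / (1 - 2 * m) * a ^ 2)) := by
    intro a b
    rw [lintegral_const_mul _ (by fun_prop), lintegral_exp_mul_sq_sub_gaussianReal h1]
  simp_rw [this]
  have : ∀ a : ℝ, ∫⁻ b, ENNReal.ofReal (Real.exp (m * (a - b) ^ 2)) *
      ENNReal.ofReal ((√(1 - 2 * m))⁻¹ * Real.exp (m / (1 - 2 * m) * a ^ 2)) ∂(gaussianReal 0 1) =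
      ENNReal.ofReal ((√(1 - 2 * m))⁻¹ * (√(1 - 2 * m))⁻¹) *
        ENNReal.ofReal (Real.exp (2 * m / (1 - 2 * m) * a ^ 2)) := by
    intro a
    rw [lintegral_mul_const _ (by fun_prop), lintegral_exp_mul_sq_sub_gaussianReal h1,
      ← ENNReal.ofReal_mul (by positivity), ← ENNReal.ofReal_mul (by positivity),
      mul_mul_mul_comm, ← Real.exp_add]
    congr 3
    ring
  simp_rw [this]
  rw [lintegral_const_mul _ (by fun_prop), lintegral_exp_mul_sq_gaussianReal,
    ← ENNReal.ofReal_mul (by positivity), mul_assoc]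
  · congr 2
    rw [← mul_inv, ← Real.sqrt_mul h0.le]
    congr 2; field_simp; ring
  · rw [div_lt_iff₀ h0]; linarith

theorem exists_inv_sqrt_one_sub_bounds {s : ℝ} (hs : 0 < s) :
    ∃ r > 0, r < 1 ∧ ∀ u : ℝ, |u| ≤ r →
      Real.exp ((1 - s) * u ^ 2 / 4) ≤ (√(1 - u))⁻¹ * Real.exp (-u / 2) ∧
      (√(1 - u))⁻¹ * Real.exp (-u / 2) ≤ Real.exp ((1 + s) * u ^ 2 / 4) := by
  refine ⟨min (1 / 2) (s / 4), by positivity, by norm_num, fun u hu => ?_⟩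
  have hu1 : |u| ≤ 1 / 2 := hu.trans (min_le_left _ _)
  have hu2 : |u| ≤ s / 4 := hu.trans (min_le_right _ _)
  have hpos : 0 < 1 - u := by linarith [le_abs_self u]
  have hlog := Real.abs_log_sub_add_sum_range_le (x := u) (by linarith) 2
  have hb : |u| ^ 3 / (1 - |u|) ≤ s / 2 * u ^ 2 := by
    rw [div_le_iff₀ (by linarith), ← sq_abs u]
    have h3 : |u| ^ 3 ≤ s / 4 * |u| ^ 2 := by
      rw [pow_succ, mul_comm]; gcongr
    nlinarith [sq_nonneg |u|, mul_nonneg hs.le (sq_nonneg |u|)]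
  simp only [Finset.sum_range_succ, Finset.sum_range_zero] at hlog
  norm_num at hlog
  have hlog2 := abs_le.1 (hlog.trans hb)
  have hrw : (√(1 - u))⁻¹ * Real.exp (-u / 2) =
      Real.exp (-(Real.log (1 - u)) / 2 - u / 2) := by
    rw [Real.sqrt_eq_rpow, ← Real.rpow_neg hpos.le, Real.rpow_def_of_pos hpos, ← Real.exp_add]
    congr 1; ring
  rw [hrw]
  constructor <;> apply Real.exp_le_exp.2 <;> nlinarith [hlog2.1, hlog2.2]

/-- The moment generating function of `S` is, up to a relative error `s` in the exponent,
that of a centred Gaussian variable of variance `w`, on the interval `[-r, r]`. -/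
structure HasQuadMGF {Ω : Type*} [MeasurableSpace Ω] (S : Ω → ℝ) (P : Measure Ω)
    (w s r : ℝ) : Prop where
  integrable : ∀ t : ℝ, |t| ≤ r → Integrable (fun ω => Real.exp (t * S ω)) P
  le_mgf : ∀ t : ℝ, |t| ≤ r → Real.exp ((1 - s) * (w * t ^ 2) / 2) ≤ mgf S P t
  mgf_le : ∀ t : ℝ, |t| ≤ r → mgf S P t ≤ Real.exp ((1 + s) * (w * t ^ 2) / 2)

theorem HasQuadMGF.sum {Ω : Type*} [MeasurableSpace Ω] {P : Measure Ω} {Y : ℕ → Ω → ℝ}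
    {w s r : ℝ} (hY : ∀ k, HasQuadMGF (Y k) P w s r) (hm : ∀ k, Measurable (Y k))
    (hi : iIndepFun Y P) (n : ℕ) :
    HasQuadMGF (fun ω => ∑ k ∈ Finset.range n, Y k ω) P (n * w) s r := by
  have := hi.isProbabilityMeasure
  have he : (fun ω => ∑ k ∈ Finset.range n, Y k ω) = ∑ k ∈ Finset.range n, Y k := by
    ext ω; simp
  rw [he]
  refine ⟨fun t ht => ?_, fun t ht => ?_, fun t ht => ?_⟩
  · exact hi.integrable_exp_mul_sum hm fun k _ => (hY k).integrable t ht
  · rw [hi.mgf_sum hm]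
    calc Real.exp ((1 - s) * (n * w * t ^ 2) / 2)
        = ∏ k ∈ Finset.range n, Real.exp ((1 - s) * (w * t ^ 2) / 2) := by
          rw [Finset.prod_const, Finset.card_range, ← Real.exp_nat_mul]; congr 1; ring
      _ ≤ _ := Finset.prod_le_prod (fun _ _ => (Real.exp_pos _).le)
          fun k _ => (hY k).le_mgf t ht
  · rw [hi.mgf_sum hm]
    calc _ ≤ ∏ k ∈ Finset.range n, Real.exp ((1 + s) * (w * t ^ 2) / 2) :=
          Finset.prod_le_prod (fun _ _ => mgf_nonneg) fun k _ => (hY k).mgf_le t ht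
      _ = _ := by
          rw [Finset.prod_const, Finset.card_range, ← Real.exp_nat_mul]; congr 1; ring

theorem integrable_exp_and_mgf_eq {Ω : Type*} [MeasurableSpace Ω] {P : Measure Ω} {Z : Ω → ℝ}
    (hZ : Measurable Z) {t c : ℝ} (hc : 0 ≤ c)
    (h : ∫⁻ ω, ENNReal.ofReal (Real.exp (t * Z ω)) ∂P = ENNReal.ofReal c) :
    Integrable (fun ω => Real.exp (t * Z ω)) P ∧ mgf Z P t = c := by
  have hm : AEStronglyMeasurable (fun ω => Real.exp (t * Z ω)) P := by fun_prop
  have h0 : 0 ≤ᵐ[P] fun ω => Real.exp (t * Z ω) := ae_of_all _ fun ω => (Real.exp_pos _).le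
  refine ⟨(lintegral_ofReal_ne_top_iff_integrable hm h0).1 (by simp [h]), ?_⟩
  rw [mgf, integral_eq_lintegral_of_nonneg_ae h0 hm, h, ENNReal.toReal_ofReal hc]

theorem map_prodMk_gaussian {Ω : Type*} [MeasurableSpace Ω] {P : Measure Ω}
    [IsProbabilityMeasure P] {ι : Type*} {X : ι → Ω → ℝ} (hm : ∀ i, Measurable (X i))
    (hl : ∀ i, P.map (X i) = gaussianReal 0 1) (hi : iIndepFun X P) {a b : ι} (hab : a ≠ b) :
    P.map (fun ω => (X a ω, X b ω)) = (gaussianReal 0 1).prod (gaussianReal 0 1) := by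
  rw [(indepFun_iff_map_prod_eq_prod_map_map (hm a).aemeasurable (hm b).aemeasurable).1
    (hi.indepFun hab), hl, hl]

theorem map_prodMk_prodMk_gaussian {Ω : Type*} [MeasurableSpace Ω] {P : Measure Ω}
    [IsProbabilityMeasure P] {ι : Type*} {X : ι → Ω → ℝ} (hm : ∀ i, Measurable (X i))
    (hl : ∀ i, P.map (X i) = gaussianReal 0 1) (hi : iIndepFun X P) {a b c : ι}
    (hab : a ≠ b) (hac : a ≠ c) (hbc : b ≠ c) :
    P.map (fun ω => ((X b ω, X c ω), X a ω)) =
      ((gaussianReal 0 1).prod (gaussianReal 0 1)).prod (gaussianReal 0 1) := by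
  rw [(indepFun_iff_map_prod_eq_prod_map_map (by fun_prop) (hm a).aemeasurable).1
    (hi.indepFun_prodMk hm b c a hab.symm hac.symm), hl, map_prodMk_gaussian hm hl hi hbc]

theorem exists_hasQuadMGF_sq_sub {s : ℝ} (hs : 0 < s) : ∃ r > 0, ∀ {Ω : Type*}
    [MeasurableSpace Ω] {P : Measure Ω} [IsProbabilityMeasure P] {ι : Type*} {X : ι → Ω → ℝ}
    (_ : ∀ i, Measurable (X i)) (_ : ∀ i, P.map (X i) = gaussianReal 0 1) (_ : iIndepFun X P)
    {a b : ι} (_ : a ≠ b), HasQuadMGF (fun ω => (X a ω - X b ω) ^ 2 - 2) P 8 s r := by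
  obtain ⟨r, hr, hr1, h⟩ := exists_inv_sqrt_one_sub_bounds hs
  refine ⟨r / 4, by positivity, ?_⟩
  intro Ω _ P _ ι X hm hl hi a b hab
  have key : ∀ t : ℝ, |t| ≤ r / 4 →
      Integrable (fun ω => Real.exp (t * ((X a ω - X b ω) ^ 2 - 2))) P ∧
      mgf (fun ω => (X a ω - X b ω) ^ 2 - 2) P t =
        (√(1 - 4 * t))⁻¹ * Real.exp (-(4 * t) / 2) := by
    intro t ht
    have ht1 : t < 1 / 4 := by linarith [le_abs_self t]
    refine integrable_exp_and_mgf_eq (by fun_prop) (by positivity) ?_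
    have : ∀ ω, ENNReal.ofReal (Real.exp (t * ((X a ω - X b ω) ^ 2 - 2))) =
        ENNReal.ofReal (Real.exp (t * (X a ω - X b ω) ^ 2)) *
          ENNReal.ofReal (Real.exp (-(4 * t) / 2)) := by
      intro ω
      rw [← ENNReal.ofReal_mul (by positivity), ← Real.exp_add]
      congr 2; ring
    simp_rw [this]
    rw [lintegral_mul_const _ (by fun_prop), ENNReal.ofReal_mul (by positivity),
      ← lintegral_exp_sq_sub ht1]
    congr 1
    rw [← lintegral_map (f := fun z : ℝ × ℝ => ENNReal.ofReal (Real.exp (t * (z.1 - z.2) ^ 2)))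
      (g := fun ω => (X a ω, X b ω)) (by fun_prop) (by fun_prop), map_prodMk_gaussian hm hl hi hab,
      lintegral_prod _ (by fun_prop)]
  have h4 : ∀ t : ℝ, |t| ≤ r / 4 → |4 * t| ≤ r := by
    intro t ht; rw [abs_mul, abs_of_pos (by norm_num : (0:ℝ) < 4)]; linarith
  refine ⟨fun t ht => (key t ht).1, fun t ht => ?_, fun t ht => ?_⟩
  · rw [(key t ht).2]
    refine le_trans (le_of_eq ?_) (h _ (h4 t ht)).1
    congr 1; ring
  · rw [(key t ht).2]
    refine (h _ (h4 t ht)).2.trans (le_of_eq ?_)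
    congr 1; ring

theorem exists_hasQuadMGF_sq_sub_add_sq_sub {s : ℝ} (hs : 0 < s) : ∃ r > 0, ∀ {Ω : Type*}
    [MeasurableSpace Ω] {P : Measure Ω} [IsProbabilityMeasure P] {ι : Type*} {X : ι → Ω → ℝ}
    (_ : ∀ i, Measurable (X i)) (_ : ∀ i, P.map (X i) = gaussianReal 0 1) (_ : iIndepFun X P)
    {a b c : ι} (_ : a ≠ b) (_ : a ≠ c) (_ : b ≠ c),
    HasQuadMGF (fun ω => ((X a ω - X b ω) ^ 2 - 2) + ((X a ω - X c ω) ^ 2 - 2)) P 20 s r := by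
  obtain ⟨r, hr, hr1, h⟩ := exists_inv_sqrt_one_sub_bounds hs
  refine ⟨r / 6, by positivity, ?_⟩
  intro Ω _ P _ ι X hm hl hi a b c hab hac hbc
  have key : ∀ t : ℝ, |t| ≤ r / 6 →
      Integrable (fun ω =>
        Real.exp (t * (((X a ω - X b ω) ^ 2 - 2) + ((X a ω - X c ω) ^ 2 - 2)))) P ∧
      mgf (fun ω => ((X a ω - X b ω) ^ 2 - 2) + ((X a ω - X c ω) ^ 2 - 2)) P t =
        ((√(1 - 2 * t))⁻¹ * Real.exp (-(2 * t) / 2)) *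
          ((√(1 - 6 * t))⁻¹ * Real.exp (-(6 * t) / 2)) := by
    intro t ht
    have ht1 : t < 1 / 6 := by linarith [le_abs_self t]
    refine integrable_exp_and_mgf_eq (by fun_prop) (by positivity) ?_
    have : ∀ ω, ENNReal.ofReal
        (Real.exp (t * (((X a ω - X b ω) ^ 2 - 2) + ((X a ω - X c ω) ^ 2 - 2)))) =
        ENNReal.ofReal (Real.exp (t * ((X a ω - X b ω) ^ 2 + (X a ω - X c ω) ^ 2))) *
          ENNReal.ofReal (Real.exp (-(2 * t) / 2) * Real.exp (-(6 * t) / 2)) := by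
      intro ω
      rw [← ENNReal.ofReal_mul (by positivity), ← Real.exp_add, ← Real.exp_add]
      congr 2; ring
    simp_rw [this]
    rw [lintegral_mul_const _ (by fun_prop), mul_mul_mul_comm,
      ENNReal.ofReal_mul (p := (√(1 - 2 * t))⁻¹ * (√(1 - 6 * t))⁻¹) (by positivity),
      ← lintegral_exp_sq_sub_add_sq_sub ht1]
    congr 1
    rw [← lintegral_map (f := fun z : (ℝ × ℝ) × ℝ =>
        ENNReal.ofReal (Real.exp (t * ((z.2 - z.1.1) ^ 2 + (z.2 - z.1.2) ^ 2))))
      (g := fun ω => ((X b ω, X c ω), X a ω)) (by fun_prop) (by fun_prop),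
      map_prodMk_prodMk_gaussian hm hl hi hab hac hbc,
      lintegral_prod_symm _ (by fun_prop)]
    refine lintegral_congr fun x => ?_
    rw [lintegral_prod _ (by fun_prop)]
  have h2 : ∀ t : ℝ, |t| ≤ r / 6 → |2 * t| ≤ r := by
    intro t ht; rw [abs_mul, abs_of_pos (by norm_num : (0:ℝ) < 2)]; linarith
  have h6 : ∀ t : ℝ, |t| ≤ r / 6 → |6 * t| ≤ r := by
    intro t ht; rw [abs_mul, abs_of_pos (by norm_num : (0:ℝ) < 6)]; linarith
  refine ⟨fun t ht => (key t ht).1, fun t ht => ?_, fun t ht => ?_⟩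
  · rw [(key t ht).2]
    refine le_trans (le_of_eq ?_) (mul_le_mul (h _ (h2 t ht)).1 (h _ (h6 t ht)).1
      (Real.exp_pos _).le (by positivity))
    rw [← Real.exp_add]
    congr 1; ring
  · rw [(key t ht).2]
    refine (mul_le_mul (h _ (h2 t ht)).2 (h _ (h6 t ht)).2 (by positivity)
      (Real.exp_pos _).le).trans (le_of_eq ?_)
    rw [← Real.exp_add]
    congr 1; ring

theorem HasQuadMGF.measureReal_ge_le {Ω : Type*} [MeasurableSpace Ω] {P : Measure Ω}
    [IsProbabilityMeasure P] {S : Ω → ℝ} {w s r x : ℝ} (h : HasQuadMGF S P w s r) (hw : 0 < w)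
    (hx : 0 ≤ x) (hxr : x ≤ r * w) :
    P.real {ω | x ≤ S ω} ≤ Real.exp (-((1 - s) * x ^ 2 / (2 * w))) := by
  have ht : 0 ≤ x / w := by positivity
  have htr : |x / w| ≤ r := by rw [abs_of_nonneg ht, div_le_iff₀ hw]; exact hxr
  calc _ ≤ Real.exp (-(x / w) * x) * mgf S P (x / w) :=
        measure_ge_le_exp_mul_mgf x ht (h.integrable _ htr)
    _ ≤ Real.exp (-(x / w) * x) * Real.exp ((1 + s) * (w * (x / w) ^ 2) / 2) := by
        gcongr; exact h.mgf_le _ htr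
    _ = _ := by rw [← Real.exp_add]; congr 1; field_simp; ring

/-- Lower tail bounds in the moderate deviation range, from the moment generating function. -/
theorem exists_le_measureReal_ge {s : ℝ} (hs : 0 < s) : ∃ s' > 0, ∃ T : ℝ, ∀ {Ω : Type*}
    [MeasurableSpace Ω] {P : Measure Ω} [IsProbabilityMeasure P] {S : Ω → ℝ} {w r x : ℝ}
    (_ : Measurable S) (_ : HasQuadMGF S P w s' r) (_ : 0 < w) (_ : 0 < x) (_ : T * w ≤ x ^ 2)
    (_ : 3 * x ≤ r * w), Real.exp (-((1 + s) * x ^ 2 / (2 * w))) ≤ P.real {ω | x ≤ S ω} := by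
  obtain ⟨a, ha, ha1, has⟩ : ∃ a : ℝ, 0 < a ∧ a ≤ 1 ∧ 9 * a ≤ s :=
    ⟨min 1 (s / 9), by positivity, min_le_left _ _, by linarith [min_le_right 1 (s / 9)]⟩
  refine ⟨a ^ 2 / 26, by positivity, 4 * Real.log 4 / a ^ 2 + 2 * Real.log 2 / a, ?_⟩
  intro Ω _ P _ S w r x hS h hw hx hT hxr
  generalize hs' : a ^ 2 / 26 = s' at h
  have hs0 : 0 < s' := by rw [← hs']; positivity
  set q := x ^ 2 / w with hq
  have hqT : 4 * Real.log 4 / a ^ 2 + 2 * Real.log 2 / a ≤ q := by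
    rw [hq, le_div_iff₀ hw]; exact hT
  have hl4 : 0 < Real.log 4 := Real.log_pos (by norm_num)
  have hl2 : 0 < Real.log 2 := Real.log_pos (by norm_num)
  have hq0 : 0 < q := by positivity
  have hqT1 : Real.log 4 ≤ a ^ 2 / 4 * q := by
    have : 4 * Real.log 4 / a ^ 2 ≤ q := le_trans (by
      have : 0 < 2 * Real.log 2 / a := by positivity
      linarith) hqT
    rw [div_le_iff₀ (by positivity)] at this; linarith
  have hqT2 : Real.log 2 ≤ a / 2 * q := by
    have : 2 * Real.log 2 / a ≤ q := le_trans (by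
      have : 0 < 4 * Real.log 4 / a ^ 2 := by positivity
      linarith) hqT
    rw [div_le_iff₀ (by positivity)] at this; linarith
  have habs : ∀ c : ℝ, 0 ≤ c → c ≤ 3 → |c * (x / w)| ≤ r := by
    intro c h0 h3
    rw [abs_of_nonneg (by positivity), ← mul_div_assoc, div_le_iff₀ hw]
    nlinarith
  have hMle : ∀ c : ℝ, 0 ≤ c → c ≤ 3 →
      mgf S P (c * (x / w)) ≤ Real.exp ((1 + s') * c ^ 2 / 2 * q) := by
    intro c h0 h3
    refine (h.mgf_le _ (habs c h0 h3)).trans (le_of_eq ?_)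
    rw [hq]; congr 1; field_simp
  have hint : ∀ c : ℝ, 0 ≤ c → c ≤ 3 →
      Integrable (fun ω => Real.exp (c * (x / w) * S ω)) P :=
    fun c h0 h3 => h.integrable _ (habs c h0 h3)
  set M := mgf S P ((1 + a) * (x / w)) with hM
  have hMge : Real.exp ((1 - s') * (1 + a) ^ 2 / 2 * q) ≤ M := by
    refine le_trans (le_of_eq ?_) (h.le_mgf _ (habs (1 + a) (by linarith) (by linarith)))
    rw [hq]; congr 1; field_simp
  set x' := (1 + 2 * a) * x with hx'
  set A := {ω | x ≤ S ω} with hA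
  have hAm : MeasurableSet A := measurableSet_le measurable_const hS
  have hpt : ∀ ω, Real.exp ((1 + a) * (x / w) * S ω) ≤
      Real.exp (a * q) * Real.exp (1 * (x / w) * S ω) +
      Real.exp (-(a * (1 + 2 * a) * q)) * Real.exp ((1 + 2 * a) * (x / w) * S ω) +
      A.indicator (fun _ => Real.exp ((1 + a) * (1 + 2 * a) * q)) ω := by
    intro ω
    have e1 : 0 ≤ A.indicator (fun _ => Real.exp ((1 + a) * (1 + 2 * a) * q)) ω :=
      Set.indicator_nonneg (fun _ _ => (Real.exp_pos _).le) _
    have e2 := Real.exp_pos (a * q + 1 * (x / w) * S ω)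
    have e3 := Real.exp_pos (-(a * (1 + 2 * a) * q) + (1 + 2 * a) * (x / w) * S ω)
    rw [← Real.exp_add, ← Real.exp_add]
    have hqx : q = x / w * x := by rw [hq]; ring
    have hxw : 0 < x / w := by positivity
    by_cases h1 : x ≤ S ω
    · by_cases h2 : S ω ≤ x'
      · have : A.indicator (fun _ => Real.exp ((1 + a) * (1 + 2 * a) * q)) ω =
            Real.exp ((1 + a) * (1 + 2 * a) * q) :=
          Set.indicator_of_mem (show ω ∈ A from h1) _
        rw [this]
        have : Real.exp ((1 + a) * (x / w) * S ω) ≤ Real.exp ((1 + a) * (1 + 2 * a) * q) := by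
          apply Real.exp_le_exp.2
          rw [hqx]
          calc (1 + a) * (x / w) * S ω ≤ (1 + a) * (x / w) * x' := by gcongr
            _ = _ := by rw [hx']; ring
        linarith
      · have : Real.exp ((1 + a) * (x / w) * S ω) ≤
            Real.exp (-(a * (1 + 2 * a) * q) + (1 + 2 * a) * (x / w) * S ω) := by
          apply Real.exp_le_exp.2
          have : 0 ≤ a * (x / w) * (S ω - x') :=
            mul_nonneg (by positivity) (by linarith)
          rw [hx'] at this
          rw [hqx]; nlinarith
        linarith
    · have : Real.exp ((1 + a) * (x / w) * S ω) ≤ Real.exp (a * q + 1 * (x / w) * S ω) := by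
        apply Real.exp_le_exp.2
        have : 0 ≤ a * (x / w) * (x - S ω) := mul_nonneg (by positivity) (by linarith)
        rw [hqx]; nlinarith
      linarith
  have hI : M ≤ Real.exp (a * q) * mgf S P (1 * (x / w)) +
      Real.exp (-(a * (1 + 2 * a) * q)) * mgf S P ((1 + 2 * a) * (x / w)) +
      P.real A * Real.exp ((1 + a) * (1 + 2 * a) * q) := by
    have i1 := (hint 1 (by norm_num) (by norm_num)).const_mul (Real.exp (a * q))
    have i2 := (hint (1 + 2 * a) (by linarith) (by linarith)).const_mul
      (Real.exp (-(a * (1 + 2 * a) * q)))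
    have i3 : Integrable (A.indicator fun _ => Real.exp ((1 + a) * (1 + 2 * a) * q)) P :=
      (integrable_const _).indicator hAm
    have i12 : Integrable (fun ω => Real.exp (a * q) * Real.exp (1 * (x / w) * S ω) +
        Real.exp (-(a * (1 + 2 * a) * q)) * Real.exp ((1 + 2 * a) * (x / w) * S ω)) P := i1.add i2
    calc M ≤ ∫ ω, (Real.exp (a * q) * Real.exp (1 * (x / w) * S ω) +
          Real.exp (-(a * (1 + 2 * a) * q)) * Real.exp ((1 + 2 * a) * (x / w) * S ω) +
          A.indicator (fun _ => Real.exp ((1 + a) * (1 + 2 * a) * q)) ω) ∂P :=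
        integral_mono (hint (1 + a) (by linarith) (by linarith)) (i12.add i3) hpt
      _ = _ := by
        rw [integral_add i12 i3, integral_add i1 i2, integral_const_mul,
          integral_const_mul, integral_indicator_const _ hAm]
        rfl
  have hexp4 : Real.exp (-(a ^ 2 / 4 * q)) ≤ 1 / 4 := by
    calc Real.exp (-(a ^ 2 / 4 * q)) ≤ Real.exp (-Real.log 4) := Real.exp_le_exp.2 (by linarith)
      _ = 1 / 4 := by rw [Real.exp_neg, Real.exp_log (by norm_num)]; norm_num
  have hM0 : 0 < M := (Real.exp_pos _).trans_le hMge
  have b1 : Real.exp (a * q) * mgf S P (1 * (x / w)) ≤ M / 4 := by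
    calc _ ≤ Real.exp (a * q) * Real.exp ((1 + s') * 1 ^ 2 / 2 * q) := by
          gcongr; exact hMle 1 (by norm_num) (by norm_num)
      _ ≤ Real.exp ((1 - s') * (1 + a) ^ 2 / 2 * q) * Real.exp (-(a ^ 2 / 4 * q)) := by
          rw [← Real.exp_add, ← Real.exp_add]
          apply Real.exp_le_exp.2
          have : a + (1 + s') * 1 ^ 2 / 2 ≤ (1 - s') * (1 + a) ^ 2 / 2 - a ^ 2 / 4 := by
            have h1 : 1 + (1 + a) ^ 2 ≤ 5 := by nlinarith only [ha, ha1]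
            have h2 : s' * (1 + (1 + a) ^ 2) ≤ s' * 5 := by gcongr
            linarith only [sq_nonneg a, h2, hs', ha, ha1]
          linarith only [mul_le_mul_of_nonneg_right this hq0.le]
      _ ≤ M * (1 / 4) := by gcongr
      _ = M / 4 := by ring
  have b2 : Real.exp (-(a * (1 + 2 * a) * q)) * mgf S P ((1 + 2 * a) * (x / w)) ≤ M / 4 := by
    calc _ ≤ Real.exp (-(a * (1 + 2 * a) * q)) *
          Real.exp ((1 + s') * (1 + 2 * a) ^ 2 / 2 * q) := by
          gcongr; exact hMle (1 + 2 * a) (by linarith) (by linarith)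
      _ ≤ Real.exp ((1 - s') * (1 + a) ^ 2 / 2 * q) * Real.exp (-(a ^ 2 / 4 * q)) := by
          rw [← Real.exp_add, ← Real.exp_add]
          apply Real.exp_le_exp.2
          have : -(a * (1 + 2 * a)) + (1 + s') * (1 + 2 * a) ^ 2 / 2 ≤
              (1 - s') * (1 + a) ^ 2 / 2 - a ^ 2 / 4 := by
            have h1 : (1 + 2 * a) ^ 2 + (1 + a) ^ 2 ≤ 13 := by nlinarith only [ha, ha1]
            have h2 : s' * ((1 + 2 * a) ^ 2 + (1 + a) ^ 2) ≤ s' * 13 := by gcongr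
            linarith only [sq_nonneg a, h2, hs', ha, ha1]
          linarith only [mul_le_mul_of_nonneg_right this hq0.le]
      _ ≤ M * (1 / 4) := by gcongr
      _ = M / 4 := by ring
  have hfin : M / 2 ≤ P.real A * Real.exp ((1 + a) * (1 + 2 * a) * q) := by linarith
  have hgoal : Real.exp (-((1 + s) * x ^ 2 / (2 * w))) * Real.exp ((1 + a) * (1 + 2 * a) * q) ≤
      M / 2 := by
    have hh : (1 + s) * x ^ 2 / (2 * w) = (1 + s) / 2 * q := by rw [hq]; ring
    calc _ ≤ Real.exp ((1 - s') * (1 + a) ^ 2 / 2 * q) * Real.exp (-Real.log 2) := by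
          rw [← Real.exp_add, ← Real.exp_add, hh]
          apply Real.exp_le_exp.2
          have : -((1 + s) / 2) + (1 + a) * (1 + 2 * a) ≤
              (1 - s') * (1 + a) ^ 2 / 2 - a / 2 := by
            have h1 : (1 + a) ^ 2 ≤ 4 := by nlinarith only [ha, ha1]
            have h2 : s' * (1 + a) ^ 2 ≤ s' * 4 := by gcongr
            linarith only [show a ^ 2 ≤ a by nlinarith only [ha, ha1], h2, hs', has, ha]
          linarith only [mul_le_mul_of_nonneg_right this hq0.le, hqT2]
      _ ≤ M * (1 / 2) := by
          rw [Real.exp_neg, Real.exp_log (by norm_num)]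
          norm_num
          linarith
      _ = M / 2 := by ring
  exact le_of_mul_le_mul_right (hgoal.trans hfin) (Real.exp_pos _)

/-- An array of independent standard normal random variables. -/
structure IsGaussianArray {Ω : Type*} [MeasurableSpace Ω] (X : ℕ → ℕ → Ω → ℝ) (P : Measure Ω) :
    Prop where
  measurable : ∀ i k, Measurable (X i k)
  map_eq : ∀ i k, P.map (X i k) = gaussianReal 0 1
  indep : iIndepFun (fun ik : ℕ × ℕ => X ik.1 ik.2) P

/-- The centred squared distance of the rows `i` and `j`, restricted to `n` columns. -/
def pairDev {Ω : Type*} (X : ℕ → ℕ → Ω → ℝ) (i j n : ℕ) (ω : Ω) : ℝ :=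
  ∑ k ∈ Finset.range n, ((X i k ω - X j k ω) ^ 2 - 2)

theorem pairDev_comm {Ω : Type*} (X : ℕ → ℕ → Ω → ℝ) (i j n : ℕ) (ω : Ω) :
    pairDev X i j n ω = pairDev X j i n ω :=
  Finset.sum_congr rfl fun _ _ => by ring

namespace IsGaussianArray

variable {Ω : Type*} [MeasurableSpace Ω] {X : ℕ → ℕ → Ω → ℝ} {P : Measure Ω}

theorem indep_rows [IsProbabilityMeasure P] (h : IsGaussianArray X P) :
    iIndepFun (fun i ω k => X i k ω) P :=
  iIndepFun_curry h.measurable h.indep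

theorem indep_cols [IsProbabilityMeasure P] (h : IsGaussianArray X P) :
    iIndepFun (fun k ω i => X i k ω) P :=
  iIndepFun_curry (X := fun k i => X i k) (fun k i => h.measurable i k)
    (h.indep.precomp (g := fun p : ℕ × ℕ => (p.2, p.1)) (by rintro ⟨a, b⟩ ⟨c, d⟩ h; simp_all))

theorem indep_col (h : IsGaussianArray X P) (k : ℕ) : iIndepFun (fun i => X i k) P :=
  h.indep.precomp (g := fun i : ℕ => (i, k)) (by intro a b h; simpa using h)

theorem measurable_pairDev (h : IsGaussianArray X P) (i j n : ℕ) :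
    Measurable (pairDev X i j n) := by
  have := h.measurable
  unfold pairDev
  fun_prop

theorem indep_sq_sub [IsProbabilityMeasure P] (h : IsGaussianArray X P) (i j : ℕ) :
    iIndepFun (fun k ω => (X i k ω - X j k ω) ^ 2 - 2) P :=
  h.indep_cols.comp (fun _ (x : ℕ → ℝ) => (x i - x j) ^ 2 - 2) (fun _ => by fun_prop)

end IsGaussianArray

theorem exists_hasQuadMGF_pairDev {s : ℝ} (hs : 0 < s) : ∃ r > 0, ∀ {Ω : Type*}
    [MeasurableSpace Ω] {X : ℕ → ℕ → Ω → ℝ} {P : Measure Ω} [IsProbabilityMeasure P]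
    (_ : IsGaussianArray X P) {i j : ℕ} (_ : i ≠ j),
    (∀ k, HasQuadMGF (fun ω => (X i k ω - X j k ω) ^ 2 - 2) P 8 s r) ∧
    ∀ n : ℕ, HasQuadMGF (pairDev X i j n) P (n * 8) s r := by
  obtain ⟨r, hr, hq⟩ := exists_hasQuadMGF_sq_sub hs
  refine ⟨r, hr, ?_⟩
  intro Ω _ X P _ h i j hij
  have h1 : ∀ k, HasQuadMGF (fun ω => (X i k ω - X j k ω) ^ 2 - 2) P 8 s r := fun k =>
    hq (X := fun i => X i k) (fun i => h.measurable i k) (fun i => h.map_eq i k) (h.indep_col k) hij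
  refine ⟨h1, fun n => HasQuadMGF.sum h1 (fun k => ?_) (h.indep_sq_sub i j) n⟩
  have := h.measurable
  fun_prop

theorem exists_hasQuadMGF_pairDev_add {s : ℝ} (hs : 0 < s) : ∃ r > 0, ∀ {Ω : Type*}
    [MeasurableSpace Ω] {X : ℕ → ℕ → Ω → ℝ} {P : Measure Ω} [IsProbabilityMeasure P]
    (_ : IsGaussianArray X P) {i j l : ℕ} (_ : i ≠ j) (_ : i ≠ l) (_ : j ≠ l) (n : ℕ),
    HasQuadMGF (fun ω => pairDev X i j n ω + pairDev X i l n ω) P (n * 20) s r := by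
  obtain ⟨r, hr, hq⟩ := exists_hasQuadMGF_sq_sub_add_sq_sub hs
  refine ⟨r, hr, ?_⟩
  intro Ω _ X P _ h i j l hij hil hjl n
  have hm := h.measurable
  have h1 : ∀ k, HasQuadMGF
      (fun ω => ((X i k ω - X j k ω) ^ 2 - 2) + ((X i k ω - X l k ω) ^ 2 - 2)) P 20 s r := fun k =>
    hq (X := fun i => X i k) (fun i => h.measurable i k) (fun i => h.map_eq i k) (h.indep_col k)
      hij hil hjl
  have := HasQuadMGF.sum h1 (fun k => by fun_prop) (h.indep_cols.comp
    (fun _ (x : ℕ → ℝ) => ((x i - x j) ^ 2 - 2) + ((x i - x l) ^ 2 - 2)) (fun _ => by fun_prop)) n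
  simpa only [pairDev, ← Finset.sum_add_distrib] using this

/-- Chernoff's bound for the running maximum of a random walk, from Doob's inequality. -/
theorem measureReal_exists_le_sum_ge_le {Ω : Type*} [MeasurableSpace Ω] {P : Measure Ω}
    {Y : ℕ → Ω → ℝ} (hm : ∀ k, Measurable (Y k)) (hi : iIndepFun Y P) {t c y : ℝ} (ht : 0 ≤ t)
    (hy : 0 < y) (hint : ∀ k, Integrable (fun ω => Real.exp (t * Y k ω)) P)
    (hmgf1 : ∀ k, 1 ≤ mgf (Y k) P t) (hmgf : ∀ k, mgf (Y k) P t ≤ c) (N : ℕ) :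
    P.real {ω | ∃ n ≤ N, y ≤ ∑ k ∈ Finset.range n, Y k ω} ≤ Real.exp (-(t * y)) * c ^ N := by
  have := hi.isProbabilityMeasure
  have hc : 0 ≤ c := zero_le_one.trans ((hmgf1 0).trans (hmgf 0))
  rcases Nat.eq_zero_or_pos N with rfl | hN
  · have : {ω | ∃ n ≤ 0, y ≤ ∑ k ∈ Finset.range n, Y k ω} = ∅ := by
      ext ω; simp [hy]
    rw [this]; simp [Real.exp_nonneg]
  obtain ⟨N, rfl⟩ : ∃ M, N = M + 1 := ⟨N - 1, by omega⟩
  set f : ℕ → Ω → ℝ := fun k ω => Real.exp (t * Y k ω) with hf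
  have hfm : ∀ k, Measurable (f k) := fun k => by have := hm k; fun_prop
  have hfi : iIndepFun f P :=
    hi.comp (fun _ x => Real.exp (t * x)) (fun _ => by fun_prop)
  have hfs : ∀ k, StronglyMeasurable (f k) := fun k => (hfm k).stronglyMeasurable
  set Z : ℕ → Ω → ℝ := fun n ω => ∏ k ∈ Finset.range (n + 1), f k ω with hZ
  have hZe : ∀ n ω, Z n ω = Real.exp (t * ∑ k ∈ Finset.range (n + 1), Y k ω) := by
    intro n ω
    simp only [hZ, hf, Finset.mul_sum, Real.exp_sum]
  have hZint : ∀ n, Integrable (Z n) P := by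
    intro n
    refine (hi.integrable_exp_mul_sum hm (s := Finset.range (n + 1))
      (fun k _ => hint k)).congr (ae_of_all _ fun ω => ?_)
    simp only [hZe, Finset.sum_apply]
  have hZI : ∀ n, ∫ ω, Z n ω ∂P ≤ c ^ (n + 1) := by
    intro n
    have := hi.mgf_sum hm (Finset.range (n + 1)) (t := t)
    have he : ∫ ω, Z n ω ∂P = ∏ k ∈ Finset.range (n + 1), mgf (Y k) P t := by
      rw [← this, mgf]
      simp only [hZe, Finset.sum_apply]
    rw [he]
    calc _ ≤ ∏ k ∈ Finset.range (n + 1), c :=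
          Finset.prod_le_prod (fun _ _ => mgf_nonneg) fun k _ => hmgf k
      _ = _ := by simp
  set F := Filtration.natural f hfs with hF
  have hfad : ∀ k n, k ≤ n → StronglyMeasurable[F n] (f k) := fun k n hkn =>
    (Filtration.stronglyAdapted_natural hfs k).mono (F.mono hkn)
  have hZad : ∀ n, StronglyMeasurable[F n] (Z n) := fun n =>
    Finset.stronglyMeasurable_fun_prod _ fun k hk =>
      hfad k n (by rw [Finset.mem_range] at hk; omega)
  have hZ0 : ∀ n ω, 0 ≤ Z n ω := fun n ω => by rw [hZe]; positivity
  have hsub : Submartingale Z F P := by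
    refine submartingale_nat hZad hZint fun n => ?_
    have hsucc : Z (n + 1) = Z n * f (n + 1) := by
      ext ω; simp only [hZ, Pi.mul_apply]; rw [Finset.prod_range_succ]
    have h1 : P[Z (n + 1) | F n] =ᵐ[P] Z n * P[f (n + 1) | F n] := by
      rw [hsucc]
      exact condExp_mul_of_stronglyMeasurable_left (hZad n) (hsucc ▸ hZint (n + 1)) (hint (n + 1))
    have h2 := hfi.condExp_natural_ae_eq_of_lt hfs (Nat.lt_succ_self n)
    filter_upwards [h1, h2] with ω h1 h2
    rw [h1, Pi.mul_apply]
    rw [Nat.succ_eq_add_one] at h2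
    rw [h2]
    exact le_mul_of_one_le_right (hZ0 n ω) (hmgf1 (n + 1))
  have hmax := maximal_ineq hsub (fun n ω => hZ0 n ω) (ε := ⟨Real.exp (t * y), by positivity⟩) N
  set A := {ω | ((⟨Real.exp (t * y), by positivity⟩ : NNReal) : ℝ) ≤
    (Finset.range (N + 1)).sup' Finset.nonempty_range_add_one fun k => Z k ω} with hA
  have hsubset : {ω | ∃ n ≤ N + 1, y ≤ ∑ k ∈ Finset.range n, Y k ω} ⊆ A := by
    rintro ω ⟨n, hn, hyn⟩
    obtain ⟨m, rfl⟩ : ∃ m, n = m + 1 := by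
      refine ⟨n - 1, ?_⟩
      rcases Nat.eq_zero_or_pos n with rfl | h0
      · simp at hyn; linarith
      · omega
    have : Real.exp (t * y) ≤ Z m ω := by
      rw [hZe]; gcongr
    exact this.trans (Finset.le_sup' (fun k => Z k ω) (Finset.mem_range.2 (by omega)))
  have hreal : Real.exp (t * y) * P.real A ≤ c ^ (N + 1) := by
    have hle : ∫ ω in A, Z N ω ∂P ≤ c ^ (N + 1) := by
      exact (setIntegral_le_integral (hZint N) (ae_of_all _ fun ω => hZ0 N ω)).trans (hZI N)
    have h3 := hmax.trans (ENNReal.ofReal_le_ofReal hle)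
    have h4 := ENNReal.toReal_mono ENNReal.ofReal_ne_top h3
    rw [ENNReal.toReal_ofReal (by positivity), ENNReal.toReal_mul] at h4
    exact h4
  calc _ ≤ P.real A := measureReal_mono hsubset
    _ = Real.exp (-(t * y)) * (Real.exp (t * y) * P.real A) := by
        rw [← mul_assoc, ← Real.exp_add]; simp
    _ ≤ _ := by gcongr

/-- The second moment method for events indexed by the edges of a complete bipartite graph, where
events of disjoint edges are uncorrelated. -/
theorem measureReal_biInter_compl_le {Ω : Type*} [MeasurableSpace Ω] {P : Measure Ω}
    [IsProbabilityMeasure P] {A : ℕ → ℕ → Set Ω} (hA : ∀ i j, MeasurableSet (A i j))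
    {S T : Finset ℕ} {q : ℕ} (hq : 0 < q) (hS : S.card = q) (hT : T.card = q) {ρ κ : ℝ}
    (hρ : 0 < ρ) (hκ : 0 ≤ κ) (hlow : ∀ i ∈ S, ∀ j ∈ T, ρ ≤ P.real (A i j))
    (hind : ∀ i ∈ S, ∀ i' ∈ S, ∀ j ∈ T, ∀ j' ∈ T, i ≠ i' → j ≠ j' →
      P.real (A i j ∩ A i' j') = P.real (A i j) * P.real (A i' j'))
    (hrow : ∀ i ∈ S, ∀ j ∈ T, ∀ j' ∈ T, j ≠ j' → P.real (A i j ∩ A i j') ≤ κ)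
    (hcol : ∀ i ∈ S, ∀ i' ∈ S, ∀ j ∈ T, i ≠ i' → P.real (A i j ∩ A i' j) ≤ κ) :
    P.real (⋂ i ∈ S, ⋂ j ∈ T, (A i j)ᶜ) ≤ 1 / (q ^ 2 * ρ) + 2 * κ / (q * ρ ^ 2) := by
  classical
  have hq0 : (0 : ℝ) < q := by exact_mod_cast hq
  set E := ⋂ i ∈ S, ⋂ j ∈ T, (A i j)ᶜ with hE
  have hEm : MeasurableSet E := by
    refine Finset.measurableSet_biInter _ fun i _ => Finset.measurableSet_biInter _ fun j _ => ?_
    exact (hA i j).compl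
  set I := S ×ˢ T with hI
  set m := ∑ a ∈ I, P.real (A a.1 a.2) with hm
  have hcard : (I.card : ℝ) = q ^ 2 := by rw [hI, Finset.card_product, hS, hT]; push_cast; ring
  have hmρ : q ^ 2 * ρ ≤ m := by
    rw [← hcard, hm, ← nsmul_eq_mul, ← Finset.sum_const]
    exact Finset.sum_le_sum fun a ha =>
      hlow _ (Finset.mem_product.1 ha).1 _ (Finset.mem_product.1 ha).2
  have hm0 : 0 < m := lt_of_lt_of_le (by positivity) hmρ
  set f : Ω → ℝ := fun ω => ∑ a ∈ I, (A a.1 a.2).indicator 1 ω with hf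
  have hind1 : ∀ B : Set Ω, MeasurableSet B → Integrable (B.indicator (1 : Ω → ℝ)) P :=
    fun B hB => (integrable_const (1 : ℝ)).indicator hB
  have hfint : Integrable f P := integrable_finsetSum _ fun a _ => hind1 _ (hA _ _)
  have hfI : ∫ ω, f ω ∂P = m := by
    rw [hf, integral_finsetSum _ fun a _ => hind1 _ (hA _ _)]
    exact Finset.sum_congr rfl fun a _ => integral_indicator_one (hA _ _)
  have hsq : ∀ ω, f ω ^ 2 = ∑ a ∈ I, ∑ b ∈ I, (A a.1 a.2 ∩ A b.1 b.2).indicator 1 ω := by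
    intro ω
    rw [sq, hf, Finset.sum_mul_sum]
    simp_rw [Set.inter_indicator_one, Pi.mul_apply]
  have hm2 : ∀ a b : ℕ × ℕ, MeasurableSet (A a.1 a.2 ∩ A b.1 b.2) :=
    fun a b => (hA _ _).inter (hA _ _)
  have hsqint : Integrable (fun ω => f ω ^ 2) P := by
    simp_rw [hsq]
    exact integrable_finsetSum _ fun a _ => integrable_finsetSum _ fun b _ => hind1 _ (hm2 a b)
  have hsqI : ∫ ω, f ω ^ 2 ∂P = ∑ a ∈ I, ∑ b ∈ I, P.real (A a.1 a.2 ∩ A b.1 b.2) := by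
    simp_rw [hsq]
    rw [integral_finsetSum _ fun a _ => integrable_finsetSum _ fun b _ => hind1 _ (hm2 a b)]
    refine Finset.sum_congr rfl fun a _ => ?_
    rw [integral_finsetSum _ fun b _ => hind1 _ (hm2 a b)]
    exact Finset.sum_congr rfl fun b _ => integral_indicator_one (hm2 a b)
  have hterm : ∀ a ∈ I, ∀ b ∈ I, P.real (A a.1 a.2 ∩ A b.1 b.2) ≤
      (if a = b then P.real (A a.1 a.2) else 0) + (if a.1 = b.1 then κ else 0) +
        (if a.2 = b.2 then κ else 0) + P.real (A a.1 a.2) * P.real (A b.1 b.2) := by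
    rintro ⟨i, j⟩ ha ⟨i', j'⟩ hb
    simp only [hI, Finset.mem_product] at ha hb
    have hnn : 0 ≤ P.real (A i j) * P.real (A i' j') := by positivity
    by_cases h1 : i = i' <;> by_cases h2 : j = j'
    · subst h1 h2
      simp only [Set.inter_self, if_true]
      linarith
    · subst h1
      have := hrow i ha.1 j ha.2 j' hb.2 h2
      simp only [Prod.mk.injEq, h2, and_false, if_false, if_true]
      linarith
    · subst h2
      have := hcol i ha.1 i' hb.1 j ha.2 h1
      simp only [Prod.mk.injEq, h1, false_and, if_false, if_true]
      linarith
    · simp only [Prod.mk.injEq, h1, h2, false_and, if_false]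
      rw [hind i ha.1 i' hb.1 j ha.2 j' hb.2 h1 h2]
      linarith
  have hsum : ∑ a ∈ I, ∑ b ∈ I, P.real (A a.1 a.2 ∩ A b.1 b.2) ≤ m + 2 * q ^ 3 * κ + m ^ 2 := by
    refine (Finset.sum_le_sum fun a ha => Finset.sum_le_sum fun b hb => hterm a ha b hb).trans ?_
    simp_rw [Finset.sum_add_distrib]
    have e1 : ∑ a ∈ I, ∑ b ∈ I, (if a = b then P.real (A a.1 a.2) else 0) = m := by
      refine Finset.sum_congr rfl fun a ha => ?_
      rw [Finset.sum_ite_eq]; simp [ha]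
    have e2 : ∑ a ∈ I, ∑ b ∈ I, (if a.1 = b.1 then κ else 0) = q ^ 3 * κ := by
      have : ∀ a ∈ I, ∑ b ∈ I, (if a.1 = b.1 then κ else 0) = q * κ := by
        intro a ha
        rw [hI, Finset.sum_product, Finset.sum_comm]
        simp [Finset.sum_ite_eq, (Finset.mem_product.1 ha).1, hT]
      rw [Finset.sum_congr rfl this, Finset.sum_const, nsmul_eq_mul, hcard]; ring
    have e3 : ∑ a ∈ I, ∑ b ∈ I, (if a.2 = b.2 then κ else 0) = q ^ 3 * κ := by
      have : ∀ a ∈ I, ∑ b ∈ I, (if a.2 = b.2 then κ else 0) = q * κ := by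
        intro a ha
        rw [hI, Finset.sum_product]
        simp [Finset.sum_ite_eq, (Finset.mem_product.1 ha).2, hS]
      rw [Finset.sum_congr rfl this, Finset.sum_const, nsmul_eq_mul, hcard]; ring
    have e4 : ∑ a ∈ I, ∑ b ∈ I, P.real (A a.1 a.2) * P.real (A b.1 b.2) = m ^ 2 := by
      rw [sq, hm, Finset.sum_mul_sum]
    rw [e1, e2, e3, e4]
    linarith
  have hEf : ∀ ω ∈ E, f ω = 0 := by
    intro ω hω
    refine Finset.sum_eq_zero fun a ha => ?_
    have := (Finset.mem_product.1 ha)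
    simp only [hE, Set.mem_iInter] at hω
    exact Set.indicator_of_notMem (hω a.1 this.1 a.2 this.2) _
  have hmain : m ^ 2 * P.real E ≤ m + 2 * q ^ 3 * κ := by
    have hpt : ∀ ω, E.indicator (fun _ => m ^ 2) ω ≤ f ω ^ 2 - 2 * m * f ω + m ^ 2 := by
      intro ω
      by_cases hω : ω ∈ E
      · rw [Set.indicator_of_mem hω, hEf ω hω]; simp
      · rw [Set.indicator_of_notMem hω]; nlinarith [sq_nonneg (f ω - m)]
    have i1 : Integrable (fun ω => f ω ^ 2 - 2 * m * f ω) P := hsqint.sub (hfint.const_mul _)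
    have := integral_mono ((integrable_const (m ^ 2)).indicator hEm)
      (i1.add (integrable_const (m ^ 2))) hpt
    rw [integral_indicator_const _ hEm, integral_add' i1 (integrable_const _),
      integral_sub hsqint (hfint.const_mul _), integral_const_mul, hfI, hsqI] at this
    simp only [smul_eq_mul, integral_const, probReal_univ, one_mul] at this
    nlinarith
  calc P.real E ≤ (m + 2 * q ^ 3 * κ) / m ^ 2 := by
        rw [le_div_iff₀ (by positivity)]; linarith
    _ = 1 / m + 2 * q ^ 3 * κ / m ^ 2 := by field_simp
    _ ≤ 1 / (q ^ 2 * ρ) + 2 * q ^ 3 * κ / (q ^ 2 * ρ) ^ 2 := by gcongr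
    _ = _ := by congr 1; field_simp

theorem ae_finite_of_summable_measureReal {Ω α : Type*} [Countable α] [MeasurableSpace Ω]
    {P : Measure Ω} [IsFiniteMeasure P] {B : α → Set Ω} {f : α → ℝ} (hf : Summable f)
    (h : ∀ a, P.real (B a) ≤ f a) : ∀ᵐ ω ∂P, {a | ω ∈ B a}.Finite := by
  refine ae_finite_setOfPred_mem
    (ne_top_of_le_ne_top hf.tsum_ofReal_ne_top (ENNReal.tsum_le_tsum fun a => ?_))
  rw [← ofReal_measureReal]
  exact ENNReal.ofReal_le_ofReal (h a)

theorem ae_eventually_notMem_of_summable {Ω : Type*} [MeasurableSpace Ω] {P : Measure Ω}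
    [IsFiniteMeasure P] {B : ℕ → Set Ω} {f : ℕ → ℝ} (hf : Summable f) (hf0 : ∀ n, 0 ≤ f n)
    (h : ∀ᶠ n in atTop, P.real (B n) ≤ f n) : ∀ᵐ ω ∂P, ∀ᶠ n in atTop, ω ∉ B n := by
  obtain ⟨N, hN⟩ := eventually_atTop.1 h
  have hfin := ae_finite_of_summable_measureReal (P := P)
    (B := fun n => {ω | ω ∈ B n ∧ N ≤ n}) hf fun n => by
      by_cases hn : N ≤ n
      · simpa [hn] using hN n hn
      · simpa [hn] using hf0 n
  filter_upwards [hfin] with ω hω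
  have := hω.eventually_cofinite_notMem
  rw [Nat.cofinite_eq_atTop] at this
  filter_upwards [this, eventually_ge_atTop N] with n hn hNn hB
  exact hn ⟨hB, hNn⟩

theorem IsGaussianArray.measureReal_inter_eq_mul {Ω : Type*} [MeasurableSpace Ω]
    {X : ℕ → ℕ → Ω → ℝ} {P : Measure Ω} [IsProbabilityMeasure P] (h : IsGaussianArray X P)
    {i j i' j' : ℕ} (h1 : i ≠ i') (h2 : i ≠ j') (h3 : j ≠ i') (h4 : j ≠ j') (n : ℕ) (x : ℝ) :
    P.real ({ω | x ≤ pairDev X i j n ω} ∩ {ω | x ≤ pairDev X i' j' n ω}) =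
      P.real {ω | x ≤ pairDev X i j n ω} * P.real {ω | x ≤ pairDev X i' j' n ω} := by
  have hm := h.measurable
  have := h.indep_rows.indepFun_prodMk_prodMk (by fun_prop) i j i' j' h1 h2 h3 h4
  have hG : MeasurableSet {z : (ℕ → ℝ) × (ℕ → ℝ) |
      x ≤ ∑ k ∈ Finset.range n, ((z.1 k - z.2 k) ^ 2 - 2)} :=
    measurableSet_le measurable_const (by fun_prop)
  have := this.measure_inter_preimage_eq_mul _ _ hG hG
  rw [measureReal_def, measureReal_def, measureReal_def, ← ENNReal.toReal_mul]
  exact congrArg ENNReal.toReal this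

theorem exists_measureReal_biInter_pairDev_lt_le {ε : ℝ} (hε : 0 < ε) (hε1 : ε ≤ 1 / 20) :
    ∃ η > 0, ∃ T₀ : ℝ, ∀ {Ω : Type*} [MeasurableSpace Ω] {X : ℕ → ℕ → Ω → ℝ} {P : Measure Ω}
    [IsProbabilityMeasure P] (_ : IsGaussianArray X P) {n : ℕ} (_ : 0 < n) {t : ℝ} (_ : 0 < t)
    (_ : T₀ ≤ t) (_ : t ≤ η * n) {S T : Finset ℕ} (_ : Disjoint S T) {q : ℕ} (_ : 0 < q)
    (_ : S.card = q) (_ : T.card = q),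
    P.real (⋂ i ∈ S, ⋂ j ∈ T, {ω | 4 * (1 - ε) * √(2 * n * t) ≤ pairDev X i j n ω}ᶜ) ≤
      Real.exp (2 * (1 - ε) * t) / q ^ 2 + 2 * Real.exp (9 / 10 * t) / q := by
  obtain ⟨s, hs, hsε, hs1⟩ : ∃ s : ℝ, 0 < s ∧ s ≤ ε ∧ s ≤ 1 / 100 :=
    ⟨min ε (1 / 100), by positivity, min_le_left _ _, min_le_right _ _⟩
  obtain ⟨s', hs', T₀, hlow⟩ := exists_le_measureReal_ge hs
  obtain ⟨r, hr, hpair⟩ := exists_hasQuadMGF_pairDev hs'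
  obtain ⟨r', hr', hadd⟩ := exists_hasQuadMGF_pairDev_add hs
  refine ⟨min (r ^ 2 / 5) (r' ^ 2 / 5), by positivity, T₀, ?_⟩
  intro Ω _ X P _ h n hn t ht hT₀ htη S T hST q hq hS hT
  have hn0 : (0 : ℝ) < n := by exact_mod_cast hn
  set x := 4 * (1 - ε) * √(2 * n * t) with hx
  have h1ε : 0 < 1 - ε := by linarith
  have hx0 : 0 < x := by positivity
  have hx2 : x ^ 2 = 32 * (1 - ε) ^ 2 * (n * t) := by
    rw [hx, mul_pow, Real.sq_sqrt (by positivity)]; ring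
  have hxr : ∀ u : ℝ, 0 < u → t ≤ u ^ 2 / 5 * n → x ≤ 8 / 3 * (u * n) := by
    intro u hu htu
    refine le_of_sq_le_sq ?_ (by positivity)
    rw [hx2]
    have e1 : (1 - ε) ^ 2 ≤ 1 := by nlinarith
    have e2 : n * t ≤ n * (u ^ 2 / 5 * n) := by gcongr
    calc 32 * (1 - ε) ^ 2 * (n * t) ≤ 32 * 1 * (n * (u ^ 2 / 5 * n)) := by gcongr
      _ ≤ _ := by nlinarith [sq_nonneg (u * n)]
  have hxr1 := hxr r hr (htη.trans (by gcongr; exact min_le_left _ _))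
  have hxr2 := hxr r' hr' (htη.trans (by gcongr; exact min_le_right _ _))
  set ρ := Real.exp (-((1 + s) * (2 * (1 - ε) ^ 2 * t))) with hρ
  set κ := Real.exp (-((1 - s) * (16 / 5 * (1 - ε) ^ 2 * t))) with hκ
  have hρle : ∀ i j : ℕ, i ≠ j → ρ ≤ P.real {ω | x ≤ pairDev X i j n ω} := by
    intro i j hij
    refine le_trans (le_of_eq ?_) (hlow (h.measurable_pairDev i j n) ((hpair h hij).2 n)
      (by positivity) hx0 ?_ ?_)
    · rw [hρ, hx2]; congr 1; field_simp; ring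
    · rw [hx2]
      have e1 : 1 / 4 ≤ (1 - ε) ^ 2 := by nlinarith
      calc T₀ * (n * 8) ≤ t * (n * 8) := by gcongr
        _ = 32 * (1 / 4) * (n * t) := by ring
        _ ≤ _ := by gcongr
    · linarith
  have hκle : ∀ i j l : ℕ, i ≠ j → i ≠ l → j ≠ l →
      P.real ({ω | x ≤ pairDev X i j n ω} ∩ {ω | x ≤ pairDev X i l n ω}) ≤ κ := by
    intro i j l hij hil hjl
    calc _ ≤ P.real {ω | 2 * x ≤ pairDev X i j n ω + pairDev X i l n ω} := by
          refine measureReal_mono ?_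
          rintro ω ⟨h1, h2⟩
          simp only [Set.mem_ofPred_eq] at h1 h2 ⊢
          linarith
      _ ≤ _ := (hadd h hij hil hjl n).measureReal_ge_le (by positivity) (by positivity)
          (by nlinarith)
      _ = κ := by rw [hκ, mul_pow, hx2]; congr 1; field_simp; ring
  have hne : ∀ i ∈ S, ∀ j ∈ T, i ≠ j := fun i hi j hj hij =>
    Finset.disjoint_left.1 hST hi (hij ▸ hj)
  have hq0 : (0 : ℝ) < q := by exact_mod_cast hq
  refine (measureReal_biInter_compl_le (P := P)
    (A := fun i j => {ω | x ≤ pairDev X i j n ω})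
    (fun i j => measurableSet_le measurable_const (h.measurable_pairDev i j n)) hq hS hT
    (Real.exp_pos _ : 0 < ρ) (Real.exp_pos _ : 0 < κ).le
    (fun i hi j hj => hρle i j (hne i hi j hj)) ?_ ?_ ?_).trans ?_
  · intro i hi i' hi' j hj j' hj' hii hjj
    exact h.measureReal_inter_eq_mul hii (hne i hi j' hj') (hne i' hi' j hj).symm hjj n x
  · intro i hi j hj j' hj' hjj
    exact hκle i j j' (hne i hi j hj) (hne i hi j' hj') hjj
  · intro i hi i' hi' j hj hii
    simp_rw [pairDev_comm X _ j]
    exact hκle j i i' (hne i hi j hj).symm (hne i' hi' j hj).symm hii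
  · have e0 : (1 + s) * (1 - ε) ^ 2 ≤ 1 - ε := by
      have : (1 + s) * (1 - ε) ≤ 1 := by nlinarith
      nlinarith
    have e1 : 1 / ρ ≤ Real.exp (2 * (1 - ε) * t) := by
      rw [hρ, one_div, ← Real.exp_neg, neg_neg]
      apply Real.exp_le_exp.2
      nlinarith [mul_le_mul_of_nonneg_right e0 ht.le]
    have e2 : κ / ρ ^ 2 ≤ Real.exp (9 / 10 * t) := by
      rw [hκ, hρ, ← Real.exp_nat_mul, ← Real.exp_sub]
      apply Real.exp_le_exp.2
      have : (1 - ε) ^ 2 * (4 * (1 + s) - 16 / 5 * (1 - s)) ≤ 1 * (9 / 10) := by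
        gcongr
        · linarith
        · nlinarith
        · linarith
      push_cast
      nlinarith [mul_le_mul_of_nonneg_right this ht.le]
    calc 1 / (q ^ 2 * ρ) + 2 * κ / (q * ρ ^ 2)
        = 1 / ρ / q ^ 2 + 2 * (κ / ρ ^ 2) / q := by
          have : ρ ≠ 0 := (Real.exp_pos _).ne'
          field_simp
      _ ≤ _ := by gcongr

/-- Independence of disjoint groups of rows amplifies the bound for a single group. -/
theorem IsGaussianArray.measureReal_forall_pairDev_lt_le {Ω : Type*} [MeasurableSpace Ω]
    {X : ℕ → ℕ → Ω → ℝ} {P : Measure Ω} [IsProbabilityMeasure P] (h : IsGaussianArray X P)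
    {n q K p : ℕ} (hq : 0 < q) (hp : K * (2 * q) ≤ p) {x b : ℝ}
    (hb : ∀ S T : Finset ℕ, Disjoint S T → S.card = q → T.card = q →
      P.real (⋂ i ∈ S, ⋂ j ∈ T, {ω | x ≤ pairDev X i j n ω}ᶜ) ≤ b) :
    P.real {ω | ∀ i < p, ∀ j < p, i ≠ j → pairDev X i j n ω < x} ≤ b ^ K := by
  have hm := h.measurable
  set G : Set (Fin (2 * q) → ℕ → ℝ) := {y | ∀ a b : Fin (2 * q), a.1 < q → q ≤ b.1 →
    ∑ k ∈ Finset.range n, ((y a k - y b k) ^ 2 - 2) < x} with hG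
  have hGm : MeasurableSet G := by
    have : G = ⋂ a, ⋂ b, {y | a.1 < q → q ≤ b.1 →
        ∑ k ∈ Finset.range n, ((y a k - y b k) ^ 2 - 2) < x} := by
      ext y; simp [hG]
    rw [this]
    refine MeasurableSet.iInter fun a => MeasurableSet.iInter fun b => ?_
    by_cases h1 : a.1 < q <;> by_cases h2 : q ≤ b.1 <;> simp only [h1, h2, true_imp_iff,
      false_imp_iff, Set.ofPred_true, MeasurableSet.univ, imp_self]
    exact measurableSet_lt (by fun_prop) measurable_const
  have hgrp : iIndepFun (fun g ω (s : Fin (2 * q)) k => X (2 * q * g + s) k ω) P := by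
    refine iIndepFun_curry (X := fun (g : ℕ) (s : Fin (2 * q)) ω k => X (2 * q * g + s) k ω)
      (fun i j => by fun_prop)
      (h.indep_rows.precomp (g := fun a : ℕ × Fin (2 * q) => 2 * q * a.1 + a.2) ?_)
    rintro ⟨g, s⟩ ⟨g', s'⟩ hgs
    simp only at hgs
    have h1 := congrArg (· / (2 * q)) hgs
    have h2 := congrArg (· % (2 * q)) hgs
    simp only [Nat.mul_add_div (show 0 < 2 * q by omega), Nat.div_eq_of_lt s.2,
      Nat.div_eq_of_lt s'.2, Nat.mul_add_mod, Nat.mod_eq_of_lt s.2, Nat.mod_eq_of_lt s'.2] at h1 h2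
    exact Prod.ext (by simpa using h1) (Fin.ext h2)
  have hprod := (iIndepFun_iff_measure_inter_preimage_eq_mul.1 hgrp) (Finset.range K)
    (sets := fun _ => G) (fun _ _ => hGm)
  have hsub : {ω | ∀ i < p, ∀ j < p, i ≠ j → pairDev X i j n ω < x} ⊆
      ⋂ g ∈ Finset.range K, (fun ω (s : Fin (2 * q)) k => X (2 * q * g + s) k ω) ⁻¹' G := by
    intro ω hω
    simp only [Set.mem_iInter, Finset.mem_range]
    intro g hg a b ha hb
    have : 2 * q * (g + 1) ≤ p := le_trans (by rw [mul_comm]; gcongr; omega) hp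
    have e : 2 * q * (g + 1) = 2 * q * g + 2 * q := by ring
    exact hω _ (by omega) _ (by omega) (by omega)
  have hone : ∀ g : ℕ,
      P.real ((fun ω (s : Fin (2 * q)) k => X (2 * q * g + s) k ω) ⁻¹' G) ≤ b := by
    intro g
    refine le_trans (measureReal_mono ?_)
      (hb (Finset.Ico (2 * q * g) (2 * q * g + q)) (Finset.Ico (2 * q * g + q) (2 * q * g + 2 * q))
        (Finset.Ico_disjoint_Ico_consecutive _ _ _) (by simp) (by simp; omega))
    intro ω hω
    simp only [Set.mem_iInter, Finset.mem_Ico, Set.mem_compl_iff, Set.mem_ofPred_eq, not_le]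
    intro i hi j hj
    have := hω ⟨i - 2 * q * g, by omega⟩ ⟨j - 2 * q * g, by omega⟩ (by simp; omega) (by simp; omega)
    simp only at this
    rwa [Nat.add_sub_cancel' hi.1, Nat.add_sub_cancel' (by omega)] at this
  calc _ ≤ P.real (⋂ g ∈ Finset.range K,
        (fun ω (s : Fin (2 * q)) k => X (2 * q * g + s) k ω) ⁻¹' G) := measureReal_mono hsub
    _ = ∏ g ∈ Finset.range K,
        P.real ((fun ω (s : Fin (2 * q)) k => X (2 * q * g + s) k ω) ⁻¹' G) := by
      rw [measureReal_def, hprod, ENNReal.toReal_prod]; rfl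
    _ ≤ ∏ g ∈ Finset.range K, b := Finset.prod_le_prod (fun _ _ => measureReal_nonneg)
        fun g _ => hone g
    _ = b ^ K := by simp

theorem eventually_le_log_of_rpow_le {p : ℕ → ℕ} {c τ : ℝ} (hc : 0 < c)
    (hlow : ∀ᶠ n : ℕ in atTop, c * (n : ℝ) ^ τ ≤ (p n : ℝ)) :
    ∀ᶠ n : ℕ in atTop, 0 < p n ∧ Real.log c + τ * Real.log n ≤ Real.log (p n) := by
  filter_upwards [hlow, eventually_gt_atTop 0] with n hn h0
  have h0' : (0 : ℝ) < n := by exact_mod_cast h0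
  have hpos : 0 < c * (n : ℝ) ^ τ := by positivity
  refine ⟨by exact_mod_cast hpos.trans_le hn, ?_⟩
  rw [← Real.log_rpow h0', ← Real.log_mul hc.ne' (by positivity)]
  exact Real.log_le_log hpos hn

theorem tendsto_log_of_rpow_le {p : ℕ → ℕ} {c τ : ℝ} (hc : 0 < c) (hτ : 0 < τ)
    (hlow : ∀ᶠ n : ℕ in atTop, c * (n : ℝ) ^ τ ≤ (p n : ℝ)) :
    Tendsto (fun n => Real.log (p n)) atTop atTop := by
  refine tendsto_atTop_mono' _
    ((eventually_le_log_of_rpow_le hc hlow).mono fun n h => h.2) ?_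
  exact tendsto_atTop_add_const_left _ _ ((Real.tendsto_log_atTop.comp
    tendsto_natCast_atTop_atTop).const_mul_atTop hτ)

theorem IsGaussianArray.ae_eventually_exists_le_pairDev {Ω : Type*} [MeasurableSpace Ω]
    {X : ℕ → ℕ → Ω → ℝ} {P : Measure Ω} [IsProbabilityMeasure P] (h : IsGaussianArray X P)
    {p : ℕ → ℕ} (hup : (fun n : ℕ => Real.log (p n)) =o[atTop] (fun n : ℕ => (n : ℝ)))
    {c τ : ℝ} (hc : 0 < c) (hτ : 0 < τ)
    (hlow : ∀ᶠ n : ℕ in atTop, c * (n : ℝ) ^ τ ≤ (p n : ℝ))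
    {ε : ℝ} (hε : 0 < ε) (hε1 : ε ≤ 1 / 20) :
    ∀ᵐ ω ∂P, ∀ᶠ n in atTop, ∃ i < p n, ∃ j < p n, i ≠ j ∧
      4 * (1 - ε) * √(2 * n * Real.log (p n)) ≤ pairDev X i j n ω := by
  obtain ⟨η, hη, T₀, hgrp⟩ := exists_measureReal_biInter_pairDev_lt_le hε hε1
  obtain ⟨K, hK⟩ := exists_nat_ge (1 / (ε * τ))
  have hK0 : (0 : ℝ) < K := lt_of_lt_of_le (by positivity) hK
  have hK1 : 0 < K := by exact_mod_cast hK0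
  have hKτ : 1 ≤ ε * K * τ := by
    rw [div_le_iff₀ (by positivity)] at hK; linarith
  set C : ℝ := (24 * K ^ 2) ^ K * Real.exp (-(2 * ε * K * Real.log c)) with hC
  have hlog := tendsto_log_of_rpow_le hc hτ hlow
  have key := ae_eventually_notMem_of_summable (P := P)
    (B := fun n => {ω | ∀ i < p n, ∀ j < p n, i ≠ j →
      pairDev X i j n ω < 4 * (1 - ε) * √(2 * n * Real.log (p n))})
    (f := fun n : ℕ => C * (1 / (n : ℝ) ^ 2))
    ((Real.summable_one_div_nat_pow.2 one_lt_two).mul_left C) (fun n => by positivity) ?_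
  · filter_upwards [key] with ω hω
    filter_upwards [hω] with n hn
    by_contra! hcon
    exact hn hcon
  filter_upwards [hup.def hη, eventually_le_log_of_rpow_le hc hlow, eventually_gt_atTop 0,
    hlog.eventually_ge_atTop T₀, hlog.eventually_gt_atTop 0,
    hlog.eventually_ge_atTop (Real.log (4 * K))] with n h1 h2 h3 h4 h5 h6
  set t := Real.log (p n) with ht
  have hn0 : (0 : ℝ) < n := by exact_mod_cast h3
  have hp0 : (0 : ℝ) < p n := by exact_mod_cast h2.1
  have hexp : Real.exp t = p n := Real.exp_log hp0
  have hp4 : 4 * (K : ℝ) ≤ p n := (Real.log_le_log_iff (by positivity) hp0).1 h6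
  rw [Real.norm_of_nonneg h5.le, Real.norm_of_nonneg hn0.le] at h1
  set q := p n / (2 * K) with hq
  have hqge : Real.exp t / (4 * K) ≤ q := by
    rw [hexp, div_le_iff₀ (by positivity)]
    have : p n < 2 * K * (q + 1) := by
      rw [hq]; exact Nat.lt_mul_div_succ _ (by omega)
    have : (p n : ℝ) < 2 * K * (q + 1) := by exact_mod_cast this
    nlinarith
  have hq0 : (0 : ℝ) < q := lt_of_lt_of_le (by positivity) hqge
  have hq1 : 0 < q := by exact_mod_cast hq0
  have hb := h.measureReal_forall_pairDev_lt_le (n := n) (K := K) (p := p n) hq1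
    (by rw [← mul_assoc, mul_comm K 2]; exact Nat.mul_div_le _ _)
    (fun S T hST hS hT => hgrp h h3 h5 h4 h1 hST hq1 hS hT)
  refine hb.trans ?_
  have hK1' : (1 : ℝ) ≤ K := by exact_mod_cast hK1
  have hb1 : Real.exp (2 * (1 - ε) * t) / q ^ 2 + 2 * Real.exp (9 / 10 * t) / q ≤
      24 * K ^ 2 * Real.exp (-(2 * ε * t)) := by
    have e1 : Real.exp (2 * (1 - ε) * t) / q ^ 2 ≤ 16 * K ^ 2 * Real.exp (-(2 * ε * t)) := by
      calc _ ≤ Real.exp (2 * (1 - ε) * t) / (Real.exp t / (4 * K)) ^ 2 := by gcongr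
        _ = 16 * K ^ 2 * (Real.exp (2 * (1 - ε) * t) / Real.exp t ^ 2) := by
          field_simp; ring
        _ = _ := by
          rw [← Real.exp_nat_mul, ← Real.exp_sub]; congr 2; push_cast; ring
    have e2 : 2 * Real.exp (9 / 10 * t) / q ≤ 8 * K ^ 2 * Real.exp (-(2 * ε * t)) := by
      calc _ ≤ 2 * Real.exp (9 / 10 * t) / (Real.exp t / (4 * K)) := by gcongr
        _ = 8 * K * (Real.exp (9 / 10 * t) / Real.exp t) := by
          field_simp; ring
        _ = 8 * K * Real.exp (-(1 / 10 * t)) := by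
          rw [← Real.exp_sub]; congr 2; ring
        _ ≤ 8 * K ^ 2 * Real.exp (-(2 * ε * t)) := by
          gcongr
          · nlinarith
          · linarith
    linarith
  calc _ ≤ (24 * K ^ 2 * Real.exp (-(2 * ε * t))) ^ K := by gcongr
    _ = (24 * K ^ 2) ^ K * Real.exp (-(2 * ε * K * t)) := by
        rw [mul_pow, ← Real.exp_nat_mul]; congr 2; ring
    _ ≤ (24 * K ^ 2) ^ K *
        (Real.exp (-(2 * ε * K * Real.log c)) * Real.exp (-(2 * Real.log n))) := by
        rw [← Real.exp_add]
        gcongr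
        have hln : 0 ≤ Real.log n := Real.log_natCast_nonneg n
        have := mul_le_mul_of_nonneg_left h2.2 (show 0 ≤ 2 * ε * K by positivity)
        nlinarith [mul_le_mul_of_nonneg_right hKτ hln]
    _ = C * (1 / (n : ℝ) ^ 2) := by
        have : Real.exp (-(2 * Real.log n)) = 1 / (n : ℝ) ^ 2 := by
          rw [Real.exp_neg, mul_comm, Real.exp_mul, Real.exp_log hn0, one_div]
          norm_cast
        rw [this, ← mul_assoc, hC]

theorem exists_measureReal_exists_le_pairDev_le {ε : ℝ} (hε : 0 < ε) (hε1 : ε ≤ 1) :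
    ∃ η > 0, ∀ {Ω : Type*} [MeasurableSpace Ω] {X : ℕ → ℕ → Ω → ℝ} {P : Measure Ω}
    [IsProbabilityMeasure P] (_ : IsGaussianArray X P) {N m : ℕ} (_ : 0 < N) (_ : 0 < m)
    (_ : (m : ℝ) ≤ η * N),
    P.real {ω | ∃ i < 2 ^ m, ∃ j < 2 ^ m, i ≠ j ∧ ∃ n ≤ N,
      4 * (1 + ε) * √(2 * N * (m * Real.log 2)) ≤ pairDev X i j n ω} ≤
      Real.exp (-(2 * ε * (m * Real.log 2))) := by
  obtain ⟨r, hr, hpair⟩ := exists_hasQuadMGF_pairDev (show 0 < ε / 2 by positivity)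
  have hl2 : 0 < Real.log 2 := Real.log_pos (by norm_num)
  refine ⟨r ^ 2 / 2 / Real.log 2, by positivity, ?_⟩
  intro Ω _ X P _ h N m hN hm hmN
  have hm0 : (0 : ℝ) < m := by exact_mod_cast hm
  have hN0 : (0 : ℝ) < N := by exact_mod_cast hN
  set u := m * Real.log 2 with hu
  have hu0 : 0 < u := by positivity
  have huN : u ≤ r ^ 2 / 2 * N := by
    rw [hu]
    calc m * Real.log 2 ≤ r ^ 2 / 2 / Real.log 2 * N * Real.log 2 := by gcongr
      _ = _ := by field_simp
  set y := 4 * (1 + ε) * √(2 * N * u) with hy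
  have hy0 : 0 < y := by positivity
  have hy2 : y ^ 2 = 32 * (1 + ε) ^ 2 * (N * u) := by
    rw [hy, mul_pow, Real.sq_sqrt (by positivity)]; ring
  have hyr : y / (8 * N) ≤ r := by
    rw [div_le_iff₀ (by positivity)]
    refine le_of_sq_le_sq ?_ (by positivity)
    rw [hy2]
    have e1 : (1 + ε) ^ 2 ≤ 4 := by nlinarith
    calc 32 * (1 + ε) ^ 2 * (N * u) ≤ 32 * 4 * (N * (r ^ 2 / 2 * N)) := by gcongr
      _ = _ := by ring
  have htr : |y / (8 * N)| ≤ r := by rwa [abs_of_nonneg (by positivity)]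
  have hone : ∀ i j : ℕ, i ≠ j → P.real {ω | ∃ n ≤ N, y ≤ pairDev X i j n ω} ≤
      Real.exp (-(2 * (1 + ε) * u)) := by
    intro i j hij
    have hmeas := h.measurable
    have hq := (hpair h hij).1
    refine (measureReal_exists_le_sum_ge_le (Y := fun k ω => (X i k ω - X j k ω) ^ 2 - 2)
      (t := y / (8 * N)) (fun k => by fun_prop) (h.indep_sq_sub i j) (by positivity) hy0
      (fun k => (hq k).integrable _ htr)
      (fun k => le_trans (Real.one_le_exp ?_) ((hq k).le_mgf _ htr))
      (fun k => (hq k).mgf_le _ htr) N).trans ?_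
    · have : 0 ≤ 1 - ε / 2 := by linarith
      positivity
    · rw [← Real.exp_nat_mul, ← Real.exp_add]
      apply Real.exp_le_exp.2
      have e : -(y / (8 * N) * y) + N * ((1 + ε / 2) * (8 * (y / (8 * N)) ^ 2) / 2) =
          -((1 - ε / 2) * (y ^ 2 / (16 * N))) := by field_simp; ring
      have e2 : y ^ 2 / (16 * N) = 2 * (1 + ε) ^ 2 * u := by rw [hy2]; field_simp; ring
      rw [e, e2]
      have : 1 ≤ (1 - ε / 2) * (1 + ε) := by nlinarith
      nlinarith [mul_le_mul_of_nonneg_right this (show 0 ≤ (1 + ε) * u by positivity)]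
  have hsub : {ω | ∃ i < 2 ^ m, ∃ j < 2 ^ m, i ≠ j ∧ ∃ n ≤ N, y ≤ pairDev X i j n ω} ⊆
      ⋃ a ∈ (Finset.range (2 ^ m) ×ˢ Finset.range (2 ^ m)).filter (fun a => a.1 ≠ a.2),
        {ω | ∃ n ≤ N, y ≤ pairDev X a.1 a.2 n ω} := by
    rintro ω ⟨i, hi, j, hj, hij, hn⟩
    simp only [Set.mem_iUnion]
    exact ⟨(i, j), by simp [hi, hj, hij], hn⟩
  calc _ ≤ ∑ a ∈ (Finset.range (2 ^ m) ×ˢ Finset.range (2 ^ m)).filter (fun a => a.1 ≠ a.2),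
        P.real {ω | ∃ n ≤ N, y ≤ pairDev X a.1 a.2 n ω} :=
        (measureReal_mono hsub (measure_ne_top _ _)).trans (measureReal_biUnion_finset_le _ _)
    _ ≤ ∑ a ∈ (Finset.range (2 ^ m) ×ˢ Finset.range (2 ^ m)).filter (fun a => a.1 ≠ a.2),
        Real.exp (-(2 * (1 + ε) * u)) :=
        Finset.sum_le_sum fun a ha => hone _ _ (Finset.mem_filter.1 ha).2
    _ ≤ ∑ a ∈ Finset.range (2 ^ m) ×ˢ Finset.range (2 ^ m), Real.exp (-(2 * (1 + ε) * u)) :=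
        Finset.sum_le_sum_of_subset_of_nonneg (Finset.filter_subset _ _)
          fun _ _ _ => (Real.exp_pos _).le
    _ = Real.exp (2 * u) * Real.exp (-(2 * (1 + ε) * u)) := by
        rw [Finset.sum_const, Finset.card_product, Finset.card_range, nsmul_eq_mul]
        congr 1
        rw [hu, show 2 * (m * Real.log 2) = ((m + m : ℕ) : ℝ) * Real.log 2 by push_cast; ring,
          Real.exp_nat_mul, Real.exp_log (by norm_num), pow_add]
        push_cast; rfl
    _ = _ := by rw [← Real.exp_add]; congr 1; ring

theorem ae_exists_forall_pairDev_lt {Ω : Type*} [MeasurableSpace Ω]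
    {X : ℕ → ℕ → Ω → ℝ} {P : Measure Ω} [IsProbabilityMeasure P]
    {ε : ℝ} (hε : 0 < ε) {η : ℝ} {N : ℕ → ℕ} (hN : ∀ l, 0 < N l) {C : ℝ} (hC : 0 < C)
    (hη : ∀ {N m : ℕ} (_ : 0 < N) (_ : 0 < m) (_ : (m : ℝ) ≤ η * N),
      P.real {ω | ∃ i < 2 ^ m, ∃ j < 2 ^ m, i ≠ j ∧ ∃ n ≤ N,
        4 * (1 + ε) * √(2 * N * (m * Real.log 2)) ≤ pairDev X i j n ω} ≤
      Real.exp (-(2 * ε * (m * Real.log 2)))) :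
    ∀ᵐ ω ∂P, ∃ L : ℕ, ∀ l ≥ L, ∀ m : ℕ, 0 < m → (l : ℝ) ≤ C * m → (m : ℝ) ≤ η * N l →
      ∀ i < 2 ^ m, ∀ j < 2 ^ m, i ≠ j → ∀ n ≤ N l,
        pairDev X i j n ω < 4 * (1 + ε) * √(2 * N l * (m * Real.log 2)) := by
  have hl2 : 0 < Real.log 2 := Real.log_pos (by norm_num)
  have hgeo : ∀ a : ℝ, 0 < a → Summable fun n : ℕ => Real.exp (-(a * n)) := by
    intro a ha
    have := Real.summable_exp_nat_mul_of_ge (c := -a) (by linarith) (f := fun n => n)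
      (fun n => le_refl _)
    refine this.congr fun n => ?_
    congr 1; ring
  have hsum := (hgeo (ε * Real.log 2 / C) (by positivity)).mul_of_nonneg
    (hgeo (ε * Real.log 2) (by positivity)) (fun _ => (Real.exp_pos _).le)
    (fun _ => (Real.exp_pos _).le)
  have key := ae_finite_of_summable_measureReal (P := P)
    (B := fun a : ℕ × ℕ => {ω | (0 < a.2 ∧ (a.1 : ℝ) ≤ C * a.2 ∧ (a.2 : ℝ) ≤ η * N a.1) ∧
      ∃ i < 2 ^ a.2, ∃ j < 2 ^ a.2, i ≠ j ∧ ∃ n ≤ N a.1,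
        4 * (1 + ε) * √(2 * N a.1 * (a.2 * Real.log 2)) ≤ pairDev X i j n ω}) hsum ?_
  · filter_upwards [key] with ω hω
    obtain ⟨L, hL⟩ := (hω.image Prod.fst).bddAbove
    refine ⟨L + 1, fun l hl m hm0 hlm hmN i hi j hj hij n hn => ?_⟩
    by_contra! hcon
    have : l ≤ L := hL ⟨(l, m), ⟨⟨hm0, hlm, hmN⟩, i, hi, j, hj, hij, n, hn, hcon⟩, rfl⟩
    omega
  · rintro ⟨l, m⟩
    by_cases hc : 0 < m ∧ (l : ℝ) ≤ C * m ∧ (m : ℝ) ≤ η * N l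
    · simp only [hc, true_and]
      refine (hη (hN l) hc.1 hc.2.2).trans ?_
      rw [← Real.exp_add]
      apply Real.exp_le_exp.2
      have : ε * Real.log 2 / C * l ≤ ε * Real.log 2 * m := by
        rw [div_mul_eq_mul_div, div_le_iff₀ hC]
        calc ε * Real.log 2 * l ≤ ε * Real.log 2 * (C * m) := by gcongr; exact hc.2.1
          _ = _ := by ring
      linarith
    · simp only [hc, false_and, Set.ofPred_false, measureReal_empty]
      positivity

theorem IsGaussianArray.ae_eventually_forall_pairDev_le {Ω : Type*} [MeasurableSpace Ω]
    {X : ℕ → ℕ → Ω → ℝ} {P : Measure Ω} [IsProbabilityMeasure P] (h : IsGaussianArray X P)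
    {p : ℕ → ℕ} (hup : (fun n : ℕ => Real.log (p n)) =o[atTop] (fun n : ℕ => (n : ℝ)))
    {c τ : ℝ} (hc : 0 < c) (hτ : 0 < τ)
    (hlow : ∀ᶠ n : ℕ in atTop, c * (n : ℝ) ^ τ ≤ (p n : ℝ))
    {ε : ℝ} (hε : 0 < ε) (hε1 : ε ≤ 1) :
    ∀ᵐ ω ∂P, ∀ᶠ n in atTop, ∀ i < p n, ∀ j < p n, i ≠ j →
      pairDev X i j n ω ≤ 4 * (1 + ε) ^ 3 * √(2 * n * Real.log (p n)) := by
  obtain ⟨η, hη, hbound⟩ := exists_measureReal_exists_le_pairDev_le hε hε1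
  have hl2 : 0 < Real.log 2 := Real.log_pos (by norm_num)
  have hR1 : 1 < 1 + ε := by linarith
  have hlR : 0 < Real.log (1 + ε) := Real.log_pos hR1
  have hlog := tendsto_log_of_rpow_le hc hτ hlow
  have hNpos : ∀ l : ℕ, 0 < ⌈(1 + ε) ^ (l + 1)⌉₊ := fun l => Nat.ceil_pos.2 (by positivity)
  have key := ae_exists_forall_pairDev_lt (P := P) (X := X) hε (η := η) (N := fun l => ⌈(1 + ε) ^ (l + 1)⌉₊) hNpos
    (C := 2 * Real.log 2 / (τ * Real.log (1 + ε))) (by positivity) (hbound h)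
  filter_upwards [key] with ω ⟨L, hL⟩
  filter_upwards [hup.def (show 0 < η * Real.log 2 / 2 by positivity),
    eventually_le_log_of_rpow_le hc hlow, eventually_gt_atTop 0,
    hlog.eventually_ge_atTop (Real.log 2), hlog.eventually_ge_atTop (Real.log 2 / ε),
    (Real.tendsto_log_atTop.comp tendsto_natCast_atTop_atTop).eventually_ge_atTop
      (-(2 * Real.log c) / τ),
    tendsto_natCast_atTop_atTop.eventually_ge_atTop ((1 + ε) ^ L),
    tendsto_natCast_atTop_atTop.eventually_ge_atTop (1 / ε)]
    with n h1 h2 h3 h4 h5 h6 h7 h8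
  intro i hi j hj hij
  set t := Real.log (p n) with ht
  have ht0 : 0 < t := hl2.trans_le h4
  have hn1 : (1 : ℝ) ≤ n := by exact_mod_cast h3
  have hn0 : (0 : ℝ) < n := by linarith
  have hp0 : (0 : ℝ) < p n := by exact_mod_cast h2.1
  have hp2 : 1 < p n := by
    have : (2 : ℝ) ≤ p n := (Real.log_le_log_iff (by norm_num) hp0).1 h4
    exact_mod_cast this
  rw [Real.norm_of_nonneg ht0.le, Real.norm_of_nonneg hn0.le] at h1
  obtain ⟨l, hl1, hl⟩ := exists_nat_pow_near hn1 hR1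
  set N := ⌈(1 + ε) ^ (l + 1)⌉₊ with hN
  have hnN : n ≤ N := by
    have : (n : ℝ) ≤ N := hl.le.trans (Nat.le_ceil _)
    exact_mod_cast this
  have hNle : (N : ℝ) ≤ (1 + ε) ^ 2 * n := by
    have e1 : (N : ℝ) < (1 + ε) ^ (l + 1) + 1 := Nat.ceil_lt_add_one (by positivity)
    have e2 : (1 + ε) ^ (l + 1) ≤ (1 + ε) * n := by rw [pow_succ, mul_comm]; gcongr
    have e3 : 1 ≤ ε * n := by
      rw [div_le_iff₀ hε] at h8; linarith
    nlinarith
  have hLl : L ≤ l := by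
    have : (1 + ε) ^ L < (1 + ε) ^ (l + 1) := h7.trans_lt hl
    have := (pow_lt_pow_iff_right₀ hR1).1 this
    omega
  set m := Nat.clog 2 (p n) with hm
  have hpm : p n ≤ 2 ^ m := Nat.le_pow_clog (by norm_num) _
  have hm0 : 0 < m := Nat.clog_pos (by norm_num) hp2
  have hmt : t ≤ m * Real.log 2 := by
    rw [ht, ← Real.log_pow]
    exact Real.log_le_log hp0 (by exact_mod_cast hpm)
  have hmt2 : m * Real.log 2 ≤ t + Real.log 2 := by
    have e1 : 2 ^ (m - 1) < p n := Nat.pow_pred_clog_lt_self (by norm_num) hp2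
    have e2 : ((2 : ℝ) ^ (m - 1)) ≤ p n := by exact_mod_cast e1.le
    have e3 := Real.log_le_log (by positivity) e2
    rw [Real.log_pow, Nat.cast_sub hm0] at e3
    push_cast at e3
    linarith
  have hlm : (l : ℝ) ≤ 2 * Real.log 2 / (τ * Real.log (1 + ε)) * m := by
    have e1 : l * Real.log (1 + ε) ≤ Real.log n := by
      rw [← Real.log_pow]; exact Real.log_le_log (by positivity) hl1
    have e2 : τ / 2 * Real.log n ≤ t := by
      have : -(2 * Real.log c) ≤ Real.log n * τ := by
        rw [div_le_iff₀ hτ] at h6; exact h6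
      linarith [h2.2]
    rw [div_mul_eq_mul_div, le_div_iff₀ (by positivity)]
    nlinarith [mul_le_mul_of_nonneg_left e1 hτ.le]
  have hmN : (m : ℝ) ≤ η * N := by
    have e1 : m * Real.log 2 ≤ η * Real.log 2 * n := by linarith
    have e2 : (m : ℝ) ≤ η * n := by
      refine le_of_mul_le_mul_right ?_ hl2
      linarith
    exact e2.trans (by gcongr)
  have hfin := hL l hLl m hm0 hlm hmN i (hi.trans_le hpm) j (hj.trans_le hpm) hij n hnN
  refine hfin.le.trans ?_
  have ht2 : m * Real.log 2 ≤ (1 + ε) ^ 2 * t := by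
    have : Real.log 2 ≤ ε * t := by rw [div_le_iff₀ hε] at h5; linarith
    nlinarith
  have hs : √(2 * N * (m * Real.log 2)) ≤ (1 + ε) ^ 2 * √(2 * n * t) := by
    refine Real.sqrt_le_iff.2 ⟨by positivity, ?_⟩
    rw [mul_pow, Real.sq_sqrt (by positivity)]
    calc 2 * N * (m * Real.log 2) ≤ 2 * ((1 + ε) ^ 2 * n) * ((1 + ε) ^ 2 * t) := by gcongr
      _ = _ := by ring
  calc _ ≤ 4 * (1 + ε) * ((1 + ε) ^ 2 * √(2 * n * t)) := by gcongr
    _ = _ := by ring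

theorem norm_arrayRow_sub_sq {Ω : Type*} (X : ℕ → ℕ → Ω → ℝ) (ω : Ω) (n i j : ℕ) :
    ‖arrayRow (fun i k => X i k ω) n i - arrayRow (fun i k => X i k ω) n j‖ ^ 2 =
      2 * n + pairDev X i j n ω := by
  rw [EuclideanSpace.norm_sq_eq, pairDev, Finset.sum_sub_distrib, ← Fin.sum_univ_eq_sum_range]
  simp [arrayRow, mul_comm]

theorem maxInterpointDist_sq_le {Ω : Type*} (X : ℕ → ℕ → Ω → ℝ) (ω : Ω) {n p : ℕ} {y : ℝ}
    (hy : 0 ≤ y) (h : ∀ i < p, ∀ j < p, i ≠ j → pairDev X i j n ω ≤ y) :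
    maxInterpointDist (fun i k => X i k ω) p n ^ 2 - 2 * n ≤ y := by
  have hle : maxInterpointDist (fun i k => X i k ω) p n ≤ √(2 * n + y) := by
    refine Real.iSup_le (fun ij => ?_) (Real.sqrt_nonneg _)
    refine Real.le_sqrt_of_sq_le ?_
    rw [norm_arrayRow_sub_sq]
    have := h _ ij.1.1.2 _ ij.1.2.2 (Fin.val_ne_of_ne ij.2.ne)
    linarith
  have h0 : 0 ≤ maxInterpointDist (fun i k => X i k ω) p n := Real.iSup_nonneg fun _ => norm_nonneg _
  have := pow_le_pow_left₀ h0 hle 2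
  rw [Real.sq_sqrt (by positivity)] at this
  linarith

theorem le_maxInterpointDist_sq {Ω : Type*} (X : ℕ → ℕ → Ω → ℝ) (ω : Ω) {n p i j : ℕ}
    (hi : i < p) (hj : j < p) (hij : i ≠ j) :
    pairDev X i j n ω ≤ maxInterpointDist (fun i k => X i k ω) p n ^ 2 - 2 * n := by
  wlog hlt : i < j generalizing i j with H
  · rw [pairDev_comm]
    exact H hj hi hij.symm (by omega)
  have hle : ‖arrayRow (fun i k => X i k ω) n i - arrayRow (fun i k => X i k ω) n j‖ ≤
      maxInterpointDist (fun i k => X i k ω) p n :=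
    le_ciSup (f := fun ij : {ij : Fin p × Fin p // ij.1 < ij.2} =>
      ‖arrayRow (fun i k => X i k ω) n ij.1.1 - arrayRow (fun i k => X i k ω) n ij.1.2‖)
      (Set.finite_range _).bddAbove ⟨(⟨i, hi⟩, ⟨j, hj⟩), hlt⟩
  have := pow_le_pow_left₀ (norm_nonneg _) hle 2
  rw [norm_arrayRow_sub_sq] at this
  linarith

theorem IsGaussianArray.ae_tendsto_maxInterpointDist {Ω : Type*} [MeasurableSpace Ω]
    {X : ℕ → ℕ → Ω → ℝ} {P : Measure Ω} [IsProbabilityMeasure P] (h : IsGaussianArray X P)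
    {p : ℕ → ℕ} (hup : (fun n : ℕ => Real.log (p n)) =o[atTop] (fun n : ℕ => (n : ℝ)))
    {c τ : ℝ} (hc : 0 < c) (hτ : 0 < τ)
    (hlow : ∀ᶠ n : ℕ in atTop, c * (n : ℝ) ^ τ ≤ (p n : ℝ)) :
    ∀ᵐ ω ∂P, Tendsto
      (fun n : ℕ => (maxInterpointDist (fun i k => X i k ω) (p n) n ^ 2 - 2 * (n : ℝ)) /
        (2 * √(2 * (n : ℝ) * Real.log (p n)))) atTop (𝓝 2) := by
  have hε : ∀ k : ℕ, 0 < 1 / (20 * ((k : ℝ) + 1)) := fun k => by positivity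
  have hε1 : ∀ k : ℕ, 1 / (20 * ((k : ℝ) + 1)) ≤ 1 / 20 := fun k => by
    apply one_div_le_one_div_of_le (by norm_num)
    have : (0 : ℝ) ≤ k := k.cast_nonneg
    linarith
  have hL := ae_all_iff.2 fun k : ℕ =>
    h.ae_eventually_exists_le_pairDev hup hc hτ hlow (hε k) (hε1 k)
  have hU := ae_all_iff.2 fun k : ℕ =>
    h.ae_eventually_forall_pairDev_le hup hc hτ hlow (hε k) ((hε1 k).trans (by norm_num))
  filter_upwards [hL, hU] with ω hL hU
  rw [Metric.tendsto_nhds]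
  intro δ hδ
  obtain ⟨k, hk⟩ := exists_nat_gt (1 / δ)
  set ε := 1 / (20 * ((k : ℝ) + 1)) with hεdef
  have hεδ : 20 * ε < δ := by
    have e1 : 20 * ε = 1 / ((k : ℝ) + 1) := by rw [hεdef]; field_simp
    rw [e1, div_lt_iff₀ (by positivity)]
    rw [div_lt_iff₀ hδ] at hk
    linarith
  filter_upwards [hL k, hU k, eventually_gt_atTop 0,
    (tendsto_log_of_rpow_le hc hτ hlow).eventually_gt_atTop 0] with n h1 h2 h3 h4
  have hn0 : (0 : ℝ) < n := by exact_mod_cast h3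
  set s := √(2 * n * Real.log (p n)) with hs
  have hs0 : 0 < s := by positivity
  obtain ⟨i, hi, j, hj, hij, hle⟩ := h1
  have hlo := hle.trans (le_maxInterpointDist_sq X ω hi hj hij)
  have hε0 : 0 < ε := hε k
  have hhi := maxInterpointDist_sq_le X ω (by positivity) h2
  rw [Real.dist_eq, abs_sub_lt_iff]
  have hcube : (1 + ε) ^ 3 ≤ 1 + 7 * ε := by
    have : ε ≤ 1 := (hε1 k).trans (by norm_num)
    nlinarith [mul_nonneg hε0.le (sub_nonneg.2 this), mul_nonneg (sq_nonneg ε) (sub_nonneg.2 this)]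
  constructor
  · rw [sub_lt_iff_lt_add, div_lt_iff₀ (by positivity)]
    refine hhi.trans_lt ?_
    have : 4 * (1 + ε) ^ 3 < (δ + 2) * 2 := by linarith
    nlinarith
  · rw [sub_lt_comm, lt_div_iff₀ (by positivity)]
    refine lt_of_lt_of_le ?_ hlo
    have : (2 - δ) * 2 < 4 * (1 - ε) := by linarith
    nlinarith

theorem mainTheorem3 {Ω : Type*} [MeasurableSpace Ω] (P : Measure Ω) [IsProbabilityMeasure P]
    (X : ℕ → ℕ → Ω → ℝ)
    (hlaw : ∀ i k, HasLaw (X i k) (gaussianReal 0 1) P)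
    (hindep : iIndepFun (fun ik : ℕ × ℕ => X ik.1 ik.2) P)
    (p : ℕ → ℕ) (β : ℝ) (hβ_pos : 0 < β) (hβ_le : β ≤ 1 / 3)
    (hp_upper : (fun n : ℕ => Real.log (p n)) =o[atTop] (fun n : ℕ => (n : ℝ) ^ β))
    (c τ : ℝ) (hc : 0 < c) (hτ : 0 < τ)
    (hp_lower : ∀ᶠ n : ℕ in atTop, c * (n : ℝ) ^ τ ≤ (p n : ℝ)) :
    ∀ᵐ ω ∂P, Tendsto
      (fun n : ℕ =>
        ((maxInterpointDist (fun i k => X i k ω) (p n) n) ^ 2 - 2 * (n : ℝ)) /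
          (2 * Real.sqrt (2 * (n : ℝ) * Real.log (p n))))
      atTop (𝓝 2) := by

  have hY : ∀ ik : ℕ × ℕ, (hlaw ik.1 ik.2).aemeasurable.mk (X ik.1 ik.2) =ᵐ[P] X ik.1 ik.2 :=
    fun ik => (hlaw ik.1 ik.2).aemeasurable.ae_eq_mk.symm
  have hG : IsGaussianArray (fun i k => (hlaw i k).aemeasurable.mk (X i k)) P :=
    { measurable := fun i k => (hlaw i k).aemeasurable.measurable_mk
      map_eq := fun i k => by rw [Measure.map_congr (hY (i, k)), (hlaw i k).map_eq]
      indep := (iIndepFun_congr hY).2 hindep }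
  have hup : (fun n : ℕ => Real.log (p n)) =o[atTop] (fun n : ℕ => (n : ℝ)) := by
    refine hp_upper.trans_isBigO (IsBigO.of_bound 1 ?_)
    filter_upwards [eventually_gt_atTop 0] with n hn
    have hn1 : (1 : ℝ) ≤ n := by exact_mod_cast hn
    rw [one_mul, Real.norm_of_nonneg (by positivity), Real.norm_of_nonneg (by positivity)]
    exact Real.rpow_le_self_of_one_le hn1 (by linarith)
  filter_upwards [hG.ae_tendsto_maxInterpointDist hup hc hτ hp_lower, ae_all_iff.2 hY]
    with ω hω hYω
  have : (fun i k => (hlaw i k).aemeasurable.mk (X i k) ω) = fun i k => X i k ω := by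
    ext i k; exact hYω (i, k)
  rwa [this] at hω
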